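/- Let $\ell>0$, $0<\sigma<1$, $\Omega=(0,\pi)\times(-\ell,\ell)$, and let $H^2_*=\{w\in H^2(\Omega): w=0 \text{ on } \{0,\pi\}\times(-\ell,\ell)\}$, whose elements are identified with their representatives continuous on $\overline\Omega$, with the scalar product $$(u,v)_{H^2_*}=\int_\Omega\left[\Delta u\,\Delta v+(1-\sigma)\left(2u_{xy}v_{xy}-u_{xx}v_{yy}-u_{yy}v_{xx}\right)\right]dx\,dy .$$ For $f\in L^2(\Omega)$, a weak solution of the partially hinged plate problem $$\begin{cases}\Delta^2u=f&\text{in }\Omega,\\ u=u_{xx}=0&\text{on }\{0,\pi\}\times(-\ell,\ell),\\ u_{yy}+\sigma u_{xx}=u_{yyy}+(2-\sigma)u_{xxy}=0&\text{on }(0,\pi)\times\{\pm\ell\}\end{cases}$$ is a function $u\in H^2_*$ with $(u,v)_{H^2_*}=\int_\Omega fv\,dx\,dy$ for all $v\in H^2_*$. **Theorem 2.1.** Let $g\in L^2(0,\pi)$ not vanish almost everywhere, let $\gamma_m=\frac2\pi\int_0^\pi g(x)\sin(mx)\,dx$ for $m\ge1$, let $\alpha\ge0$ with $\alpha\notin\{1,2,3,\dots\}$,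 and let $$f(x,y)=K_\alpha e^{\alpha y}g(x),\qquad K_\alpha=\frac{\alpha}{2\sinh(\alpha\ell)\int_0^\pi|g(x)|\,dx}\ \text{ if }\alpha>0,\qquad K_0=\lim_{\alpha\to0^+}K_\alpha=\frac{1}{2\ell\int_0^\pi|g(x)|\,dx}.$$ Then for each integer $m\ge1$ the two linear systems $$\begin{cases}(1-\sigma)m^2\cosh(m\ell)\,A+m\left[2\cosh(m\ell)+(1-\sigma)m\ell\sinh(m\ell)\right]D=\gamma_m\frac{\sigma m^2-\alpha^2}{(m^2-\alpha^2)^2}\cosh(\alpha\ell)\\ (\sigma-1)m^3\sinh(m\ell)\,A+m^2\left[(1+\sigma)\sinh(m\ell)+(\sigma-1)m\ell\cosh(m\ell)\right]D=\alpha\gamma_m\frac{(2-\sigma)m^2-\alpha^2}{(m^2-\alpha^2)^2}\sinh(\alpha\ell)\end{cases}$$ $$\begin{cases}(1-\sigma)m^2\sinh(m\ell)\,B+m\left[2\sinh(m\ell)+(1-\sigma)m\ell\cosh(m\ell)\right]C=\gamma_m\frac{\sigma m^2-\alpha^2}{(m^2-\alpha^2)^2}\sinh(\alpha\ell)\\ (\sigma-1)m^3\cosh(m\ell)\,B+m^2\left[(1+\sigma)\cosh(m\ell)+(\sigma-1)m\ell\sinh(m\ell)\right]C=\alpha\gamma_m\frac{(2-\sigma)m^2-\alpha^2}{(m^2-\alpha^2)^2}\cosh(\alpha\ell)\end{cases}$$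 have unique solutions $(A,D)=(A_m,D_m)$ and $(B,C)=(B_m,C_m)$ in $\mathbb R^2$. The plate problem with load $f$ has exactly one weak solution $u\in H^2_*$, and for all $(x,y)\in\overline\Omega$ $$u(x,y)=K_\alpha\sum_{m=1}^{+\infty}\left[\frac{\gamma_m e^{\alpha y}}{(m^2-\alpha^2)^2}+A_m\cosh(my)+B_m\sinh(my)+C_m\,y\cosh(my)+D_m\,y\sinh(my)\right]\sin(mx),$$ where the series converges absolutely at each point of $\overline\Omega$ and uniformly on $\overline\Omega$. -/

import Mathlib

open MeasureTheory Set Filter Topology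
open scoped ContDiff

noncomputable section

namespace Plate

/-- The coordinate directions of the plane: `dir 0` is the `x`-direction, `dir 1` the
`y`-direction. -/
def dir (i : Fin 2) : ℝ × ℝ := if i = 0 then (1, 0) else (0, 1)

/-- `g` is the weak (distributional) partial derivative of `u` in the `i`-th coordinate direction
on the open set `Ω`, tested against all smooth functions with compact support in `Ω`. -/
def HasWeakPartial (Ω : Set (ℝ × ℝ)) (i : Fin 2) (u g : ℝ × ℝ → ℝ) : Prop :=
  LocallyIntegrableOn u Ω ∧ LocallyIntegrableOn g Ω ∧
    ∀ φ : ℝ × ℝ → ℝ, ContDiff ℝ ∞ φ → HasCompactSupport φ → tsupport φ ⊆ Ω →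
      ∫ p in Ω, u p * fderiv ℝ φ p (dir i) = -∫ p in Ω, g p * φ p

open Classical in
/-- The weak partial derivative (unique up to null sets when it exists, and `0` otherwise). -/
def weakPartial (Ω : Set (ℝ × ℝ)) (i : Fin 2) (u : ℝ × ℝ → ℝ) : ℝ × ℝ → ℝ :=
  if h : ∃ g, HasWeakPartial Ω i u g then h.choose else 0

/-- `u ∈ H¹(Ω)`: `u` and its first weak partial derivatives exist and are square integrable. -/
def MemH1 (Ω : Set (ℝ × ℝ)) (u : ℝ × ℝ → ℝ) : Prop :=
  MemLp u 2 (volume.restrict Ω) ∧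
    ∀ i, (∃ g, HasWeakPartial Ω i u g) ∧ MemLp (weakPartial Ω i u) 2 (volume.restrict Ω)

/-- `u ∈ H²(Ω)`: `u` and its first weak partial derivatives are in `H¹(Ω)`. -/
def MemH2 (Ω : Set (ℝ × ℝ)) (u : ℝ × ℝ → ℝ) : Prop :=
  MemH1 Ω u ∧ ∀ i, MemH1 Ω (weakPartial Ω i u)

/-- The plate `Ω = (0,π) × (-ℓ,ℓ)`. -/
def plate (ℓ : ℝ) : Set (ℝ × ℝ) := Ioo 0 Real.pi ×ˢ Ioo (-ℓ) ℓ

/-- The closed plate `[0,π] × [-ℓ,ℓ]`. -/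
def closedPlate (ℓ : ℝ) : Set (ℝ × ℝ) := Icc 0 Real.pi ×ˢ Icc (-ℓ) ℓ

/-- The space `H²_*` of those `w ∈ H²(Ω)` with `w = 0` on the hinged edges `{0,π} × (-ℓ,ℓ)`.
Since `H²(Ω) ⊂ C⁰(closure Ω)` in dimension two, an element is represented by its representative
that is continuous on the closed plate, and the boundary condition is pointwise. -/
structure MemH2Star (ℓ : ℝ) (w : ℝ × ℝ → ℝ) : Prop where
  memH2 : MemH2 (plate ℓ) w
  continuousOn : ContinuousOn w (closedPlate ℓ)
  hinged : ∀ y ∈ Ioo (-ℓ) ℓ, w (0, y) = 0 ∧ w (Real.pi, y) = 0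

/-- The weak second derivative `∂_j ∂_i u` on the plate. -/
def weakPartial₂ (ℓ : ℝ) (i j : Fin 2) (u : ℝ × ℝ → ℝ) : ℝ × ℝ → ℝ :=
  weakPartial (plate ℓ) j (weakPartial (plate ℓ) i u)

/-- The weak Laplacian on the plate. -/
def weakLaplacian (ℓ : ℝ) (u : ℝ × ℝ → ℝ) (p : ℝ × ℝ) : ℝ :=
  weakPartial₂ ℓ 0 0 u p + weakPartial₂ ℓ 1 1 u p

/-- The scalar product
`(u,v) = ∫_Ω Δu Δv + (1-σ) (2 u_xy v_xy - u_xx v_yy - u_yy v_xx)` of `H²_*`. -/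
def plateForm (ℓ σ : ℝ) (u v : ℝ × ℝ → ℝ) : ℝ :=
  ∫ p in plate ℓ,
    (weakLaplacian ℓ u p * weakLaplacian ℓ v p
      + (1 - σ) * (2 * weakPartial₂ ℓ 0 1 u p * weakPartial₂ ℓ 0 1 v p
        - weakPartial₂ ℓ 0 0 u p * weakPartial₂ ℓ 1 1 v p
        - weakPartial₂ ℓ 1 1 u p * weakPartial₂ ℓ 0 0 v p))

/-- `u` is a weak solution of the partially hinged plate problem with load `f ∈ L²(Ω)`:
`u ∈ H²_*` and `(u,v) = ∫_Ω f v` for all `v ∈ H²_*`. -/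
def IsWeakSolution (ℓ σ : ℝ) (f u : ℝ × ℝ → ℝ) : Prop :=
  MemH2Star ℓ u ∧ ∀ v, MemH2Star ℓ v → plateForm ℓ σ u v = ∫ p in plate ℓ, f p * v p

/-- The normalization constant `K_α = α / (2 sinh(αℓ) ∫₀^π |g|)`, which makes the load have unit
`L¹` norm; for `α = 0` it is the constant with that property, `1 / (2ℓ ∫₀^π |g|)`, which is also
the limit as `α → 0`. -/
def loadConst (ℓ α : ℝ) (g : ℝ → ℝ) : ℝ :=
  if α = 0 then 1 / (2 * ℓ * ∫ x in (0 : ℝ)..Real.pi, |g x|)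
  else α / (2 * Real.sinh (α * ℓ) * ∫ x in (0 : ℝ)..Real.pi, |g x|)

/-- The load `f_α(x,y) = K_α e^{αy} g(x)`. -/
def load (ℓ α : ℝ) (g : ℝ → ℝ) (p : ℝ × ℝ) : ℝ :=
  loadConst ℓ α g * Real.exp (α * p.2) * g p.1

/-- The sine coefficients `γ_m = (2/π) ∫₀^π g(x) sin(mx) dx`. -/
def sineCoeff (g : ℝ → ℝ) (m : ℕ) : ℝ :=
  2 / Real.pi * ∫ x in (0 : ℝ)..Real.pi, g x * Real.sin (m * x)

/-- The `2 × 2` linear system for `A` and `D` (with `γ = γ_m`). -/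
def SystemAD (ℓ σ α γ : ℝ) (m : ℕ) (A D : ℝ) : Prop :=
  (1 - σ) * m ^ 2 * Real.cosh (m * ℓ) * A
      + m * (2 * Real.cosh (m * ℓ) + (1 - σ) * m * ℓ * Real.sinh (m * ℓ)) * D
    = γ * ((σ * m ^ 2 - α ^ 2) / (m ^ 2 - α ^ 2) ^ 2) * Real.cosh (α * ℓ) ∧
  (σ - 1) * m ^ 3 * Real.sinh (m * ℓ) * A
      + m ^ 2 * ((1 + σ) * Real.sinh (m * ℓ) + (σ - 1) * m * ℓ * Real.cosh (m * ℓ)) * D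
    = α * γ * (((2 - σ) * m ^ 2 - α ^ 2) / (m ^ 2 - α ^ 2) ^ 2) * Real.sinh (α * ℓ)

/-- The `2 × 2` linear system for `B` and `C` (with `γ = γ_m`). -/
def SystemBC (ℓ σ α γ : ℝ) (m : ℕ) (B C : ℝ) : Prop :=
  (1 - σ) * m ^ 2 * Real.sinh (m * ℓ) * B
      + m * (2 * Real.sinh (m * ℓ) + (1 - σ) * m * ℓ * Real.cosh (m * ℓ)) * C
    = γ * ((σ * m ^ 2 - α ^ 2) / (m ^ 2 - α ^ 2) ^ 2) * Real.sinh (α * ℓ) ∧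
  (σ - 1) * m ^ 3 * Real.cosh (m * ℓ) * B
      + m ^ 2 * ((1 + σ) * Real.cosh (m * ℓ) + (σ - 1) * m * ℓ * Real.sinh (m * ℓ)) * C
    = α * γ * (((2 - σ) * m ^ 2 - α ^ 2) / (m ^ 2 - α ^ 2) ^ 2) * Real.cosh (α * ℓ)

/-- The `m`-th coefficient
`γ e^{αy} / (m²-α²)² + A cosh(my) + B sinh(my) + C y cosh(my) + D y sinh(my)`. -/
def modeCoeff (α γ : ℝ) (m : ℕ) (A B C D y : ℝ) : ℝ :=
  γ * Real.exp (α * y) / (m ^ 2 - α ^ 2) ^ 2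
    + A * Real.cosh (m * y) + B * Real.sinh (m * y)
    + C * y * Real.cosh (m * y) + D * y * Real.sinh (m * y)

/-- The `m`-th term of the series for the solution, without the factor `K_α`. -/
def seriesTerm (α : ℝ) (g : ℝ → ℝ) (A B C D : ℕ → ℝ) (m : ℕ) (p : ℝ × ℝ) : ℝ :=
  modeCoeff α (sineCoeff g m) m (A m) (B m) (C m) (D m) p.2 * Real.sin (m * p.1)

end Plate

end

namespace Plate

/-! ### Smooth cutoffs on an interval -/

/-! The proof is separation of variables, made rigorous without trace theory, density theorems or
Lax–Milgram.

Expanding `g` in sines, a mode `Y(y) sin(mx)` must satisfy `Y'''' - 2m²Y'' + m⁴Y = γ_m e^{αy}` and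
the natural boundary conditions at `±ℓ`. The bracket in the series is the general solution of this
equation. Its even and odd parts in `y` decouple the four boundary equations into the two linear
systems, whose determinants are positive because `t ≤ sinh t cosh t`. Uniformly in `m`, the
coefficients are `O(|γ_m| m⁻³ / cosh(mℓ))` (`exists_modeSize_le`). Hence all derivatives of order at
most two of the `m`-th term are `O(|γ_m| / m)`, which is summable by Bessel's inequality. The series
therefore lies in `H²_*` and may be integrated termwise (`MajorizedSeries`).

The weak equation is checked mode by mode. `MemH2Star.green_mode` moves all derivatives from an
arbitrary `v ∈ H²_*` onto a single mode, and Parseval's identity (`hasSum_load_pairing`) sums the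
results to the load. Derivatives of order three and four are never summed. Test functions have
compact support, so Green's formula up to the boundary is obtained by cutting off products `a(x)
b(y)` and passing to the limit by dominated convergence.

For uniqueness, the form dominates `(1-σ)∫ v_xx²`. If it vanishes at `v`, integrating by parts twice
in `x` makes every sine coefficient of `v` vanish, and completeness of the sines gives `v = 0`. -/

theorem deriv_smoothTransition_eq_zero {x : ℝ} (hx : x < 0 ∨ 1 < x) :
    deriv Real.smoothTransition x = 0 := by
  rcases hx with hx | hx
  · have : Real.smoothTransition =ᶠ[𝓝 x] fun _ => 0 := by
      filter_upwards [Iio_mem_nhds hx] with y hy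
      exact Real.smoothTransition.zero_of_nonpos (le_of_lt hy)
    rw [this.deriv_eq]; simp
  · have : Real.smoothTransition =ᶠ[𝓝 x] fun _ => 1 := by
      filter_upwards [Ioi_mem_nhds hx] with y hy
      exact Real.smoothTransition.one_of_one_le (le_of_lt hy)
    rw [this.deriv_eq]; simp

theorem exists_bound_deriv_smoothTransition :
    ∃ C, 0 ≤ C ∧ ∀ x, |deriv Real.smoothTransition x| ≤ C := by
  have hc : Continuous (deriv Real.smoothTransition) :=
    (Real.smoothTransition.contDiff (n := 1)).continuous_deriv (by simp)
  obtain ⟨C, hC⟩ := (isCompact_Icc (a := (0 : ℝ)) (b := 1)).exists_bound_of_continuousOn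
    hc.continuousOn
  refine ⟨max C 0, le_max_right _ _, fun x => ?_⟩
  by_cases hx : x ∈ Icc (0 : ℝ) 1
  · exact (hC x hx).trans (le_max_left _ _)
  · have : x < 0 ∨ 1 < x := by
      by_contra! h
      exact hx ⟨h.1, h.2⟩
    rw [deriv_smoothTransition_eq_zero this]; simp

/-- Smooth cutoff functions exhausting an open interval, with derivatives supported in layers of
width `2 / (n + 1)` at the end points and of size `O(n)`. -/
theorem exists_cutoff (a b : ℝ) : ∃ (χ : ℕ → ℝ → ℝ) (C : ℝ), 0 ≤ C ∧
    ∀ n, ContDiff ℝ ∞ (χ n) ∧ HasCompactSupport (χ n) ∧ tsupport (χ n) ⊆ Ioo a b ∧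
      (∀ x, |χ n x| ≤ 1) ∧
      (∀ x, 2 / (n + 1 : ℝ) ≤ x - a → 2 / (n + 1 : ℝ) ≤ b - x → χ n x = 1) ∧
      (∀ x, |deriv (χ n) x| ≤ C * (n + 1)) ∧
      (∀ x, 2 / (n + 1 : ℝ) < x - a → 2 / (n + 1 : ℝ) < b - x → deriv (χ n) x = 0) := by
  obtain ⟨C, hC0, hC⟩ := exists_bound_deriv_smoothTransition
  set S := Real.smoothTransition with hS
  have hSs : ContDiff ℝ ∞ S := Real.smoothTransition.contDiff
  -- Each factor is `0` within distance `1 / (n + 1)` of its end point and `1` beyond distance `2 /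
  -- (n + 1)`. The two terms of the product rule account for `2 * C`.
  refine ⟨fun n x => S ((n + 1) * (x - a) - 1) * S ((n + 1) * (b - x) - 1), 2 * C, by positivity,
    fun n => ?_⟩
  have hN : (0 : ℝ) < n + 1 := by positivity
  have hsub : Function.support (fun x => S ((n + 1) * (x - a) - 1) * S ((n + 1) * (b - x) - 1)) ⊆
      Icc (a + 1 / (n + 1)) (b - 1 / (n + 1)) := by
    intro x hx
    simp only [Function.mem_support, ne_eq, mul_eq_zero, not_or, hS,
      Real.smoothTransition.zero_iff_nonpos, not_le] at hx
    constructor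
    · have : 1 / (n + 1 : ℝ) < x - a := by rw [div_lt_iff₀ hN]; linarith
      linarith
    · have : 1 / (n + 1 : ℝ) < b - x := by rw [div_lt_iff₀ hN]; linarith
      linarith
  have hd : ∀ x, HasDerivAt
      (fun x => S ((n + 1) * (x - a) - 1) * S ((n + 1) * (b - x) - 1))
      (deriv S ((n + 1) * (x - a) - 1) * (n + 1) * S ((n + 1) * (b - x) - 1) +
        S ((n + 1) * (x - a) - 1) * (deriv S ((n + 1) * (b - x) - 1) * (-(n + 1)))) x := by
    intro x
    have hSd : ∀ y, HasDerivAt S (deriv S y) y := fun y =>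
      (hSs.differentiable (by simp) y).hasDerivAt
    have h1 : HasDerivAt (fun x : ℝ => (n + 1 : ℝ) * (x - a) - 1) (n + 1) x := by
      simpa using (((hasDerivAt_id x).sub_const a).const_mul (n + 1 : ℝ)).sub_const 1
    have h2 : HasDerivAt (fun x : ℝ => (n + 1 : ℝ) * (b - x) - 1) (-(n + 1)) x := by
      simpa using (((hasDerivAt_id x).const_sub b).const_mul (n + 1 : ℝ)).sub_const 1
    exact ((hSd _).comp x h1).mul ((hSd _).comp x h2)
  have habs : ∀ y, |S y| ≤ 1 := fun y => by
    rw [abs_of_nonneg (Real.smoothTransition.nonneg y)]; exact Real.smoothTransition.le_one y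
  refine ⟨by fun_prop, ?_, ?_, ?_, ?_, ?_, ?_⟩
  · exact HasCompactSupport.of_support_subset_isCompact isCompact_Icc hsub
  · refine (closure_minimal hsub isClosed_Icc).trans ?_
    intro x hx
    have : 0 < 1 / (n + 1 : ℝ) := by positivity
    exact ⟨by linarith [hx.1], by linarith [hx.2]⟩
  · intro x
    rw [abs_mul]
    exact mul_le_one₀ (habs _) (abs_nonneg _) (habs _)
  · intro x h1 h2
    rw [div_le_iff₀ hN] at h1 h2
    simp only [hS]
    rw [Real.smoothTransition.one_of_one_le (by linarith),
      Real.smoothTransition.one_of_one_le (by linarith), mul_one]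
  · intro x
    rw [(hd x).deriv]
    refine (abs_add_le _ _).trans ?_
    rw [abs_mul, abs_mul, abs_mul, abs_mul, abs_neg, abs_of_pos hN]
    have e1 : |deriv S ((n + 1) * (x - a) - 1)| * (n + 1) * |S ((n + 1) * (b - x) - 1)|
        ≤ C * (n + 1) * 1 := by
      gcongr
      · exact hC _
      · exact habs _
    have e2 : |S ((n + 1) * (x - a) - 1)| * (|deriv S ((n + 1) * (b - x) - 1)| * (n + 1))
        ≤ 1 * (C * (n + 1)) := by
      gcongr
      · exact habs _
      · exact hC _
    linarith
  · intro x h1 h2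
    rw [div_lt_iff₀ hN] at h1 h2
    rw [(hd x).deriv, deriv_smoothTransition_eq_zero (Or.inr (by linarith)),
      deriv_smoothTransition_eq_zero (Or.inr (by linarith))]
    ring

theorem eventually_two_div_lt {δ : ℝ} (hδ : 0 < δ) : ∀ᶠ n : ℕ in atTop, 2 / (n + 1 : ℝ) < δ := by
  have : Tendsto (fun n : ℕ => 2 / (n + 1 : ℝ)) atTop (𝓝 0) := by
    simpa [div_eq_mul_inv] using
      (tendsto_one_div_add_atTop_nhds_zero_nat (𝕜 := ℝ)).const_mul 2
  exact this.eventually (gt_mem_nhds hδ)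

theorem exists_bound_Icc {k : ℝ → ℝ} (hk : Continuous k) (a b : ℝ) :
    ∃ M, 0 ≤ M ∧ ∀ x ∈ Icc a b, |k x| ≤ M := by
  obtain ⟨C, hC⟩ := (isCompact_Icc (a := a) (b := b)).exists_bound_of_continuousOn
    hk.continuousOn
  exact ⟨max C 0, le_max_right _ _, fun x hx => (hC x hx).trans (le_max_left _ _)⟩

/-- A smooth function is the bounded pointwise limit on `(a, b)` of test functions. -/
theorem exists_testFunction_approx {k : ℝ → ℝ} (hk : ContDiff ℝ ∞ k) (a b : ℝ) :
    ∃ (φ : ℕ → ℝ → ℝ) (M : ℝ), ∀ n, ContDiff ℝ ∞ (φ n) ∧ HasCompactSupport (φ n) ∧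
      tsupport (φ n) ⊆ Ioo a b ∧ (∀ x ∈ Ioo a b, |φ n x| ≤ M) ∧
      (∀ x ∈ Ioo a b, Tendsto (fun n => φ n x) atTop (𝓝 (k x))) := by
  obtain ⟨χ, C, hC0, hχ⟩ := exists_cutoff a b
  obtain ⟨M, hM0, hM⟩ := exists_bound_Icc hk.continuous a b
  refine ⟨fun n x => χ n x * k x, M, fun n => ?_⟩
  obtain ⟨h1, h2, h3, h4, h5, h6, h7⟩ := hχ n
  refine ⟨h1.mul hk, h2.mul_right, (tsupport_mul_subset_left).trans h3, fun x hx => ?_,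
    fun x hx => ?_⟩
  · rw [abs_mul]
    calc |χ n x| * |k x| ≤ 1 * M := by
          gcongr
          · exact h4 x
          · exact hM x ⟨hx.1.le, hx.2.le⟩
      _ = M := one_mul M
  · refine tendsto_const_nhds.congr' ?_
    filter_upwards [eventually_two_div_lt (sub_pos.2 hx.1), eventually_two_div_lt (sub_pos.2 hx.2)]
      with n hn1 hn2
    rw [(hχ n).2.2.2.2.1 x hn1.le hn2.le, one_mul]

/-- A smooth function vanishing at `a` and `b` is, together with its derivative, the bounded
pointwise limit on `(a, b)` of test functions. -/
theorem exists_testFunction_approx_deriv {k : ℝ → ℝ} (hk : ContDiff ℝ ∞ k) {a b : ℝ}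
    (ha : k a = 0) (hb : k b = 0) :
    ∃ (φ : ℕ → ℝ → ℝ) (M : ℝ), ∀ n, ContDiff ℝ ∞ (φ n) ∧ HasCompactSupport (φ n) ∧
      tsupport (φ n) ⊆ Ioo a b ∧ (∀ x ∈ Ioo a b, |φ n x| ≤ M) ∧
      (∀ x ∈ Ioo a b, |deriv (φ n) x| ≤ M) ∧
      (∀ x ∈ Ioo a b, Tendsto (fun n => φ n x) atTop (𝓝 (k x))) ∧
      (∀ x ∈ Ioo a b, Tendsto (fun n => deriv (φ n) x) atTop (𝓝 (deriv k x))) := by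
  obtain ⟨χ, C, hC0, hχ⟩ := exists_cutoff a b
  obtain ⟨M, hM0, hM⟩ := exists_bound_Icc hk.continuous a b
  have hk' : Continuous (deriv k) := (hk.of_le (m := 1) (by simp)).continuous_deriv le_rfl
  obtain ⟨L, hL0, hL⟩ := exists_bound_Icc hk' a b
  have hkd : Differentiable ℝ k := hk.differentiable (by simp)
  have hlip : ∀ x ∈ Icc a b, ∀ y ∈ Icc a b, |k y - k x| ≤ L * |y - x| := fun x hx y hy =>
    (convex_Icc a b).norm_image_sub_le_of_norm_deriv_le (fun z _ => hkd z) hL hx hy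
  have hdiff : ∀ n x, deriv (fun x => χ n x * k x) x = deriv (χ n) x * k x + χ n x * deriv k x :=
    fun n x => deriv_fun_mul ((hχ n).1.differentiable (by simp) x) (hkd x)
  -- The cutoff derivative is `O(n)`, but only in layers of width `2 / (n + 1)`. There `k`, being
  -- Lipschitz and zero at the end point, is `O(1/n)`, so the product stays bounded.
  have hbd : ∀ n, ∀ x ∈ Ioo a b, |deriv (χ n) x * k x| ≤ 2 * C * L := by
    intro n x hx
    obtain ⟨h1, h2, h3, h4, h5, h6, h7⟩ := hχ n
    have hN : (0 : ℝ) < n + 1 := by positivity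
    have hab : a ≤ b := (hx.1.trans hx.2).le
    have key : ∀ t, t ≤ 2 / (n + 1 : ℝ) → |k x| ≤ L * t →
        |deriv (χ n) x * k x| ≤ 2 * C * L := by
      intro t ht hkt
      rw [abs_mul]
      calc |deriv (χ n) x| * |k x| ≤ (C * (n + 1)) * (L * (2 / (n + 1))) := by
            gcongr
            · exact h6 x
            · exact hkt.trans (by gcongr)
        _ = 2 * C * L := by field_simp
    by_cases c1 : x - a ≤ 2 / (n + 1 : ℝ)
    · refine key _ c1 ?_
      have := hlip a ⟨le_rfl, hab⟩ x ⟨hx.1.le, hx.2.le⟩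
      rwa [ha, sub_zero, abs_of_pos (sub_pos.2 hx.1)] at this
    by_cases c2 : b - x ≤ 2 / (n + 1 : ℝ)
    · refine key _ c2 ?_
      have := hlip b ⟨hab, le_rfl⟩ x ⟨hx.1.le, hx.2.le⟩
      rwa [hb, sub_zero, abs_sub_comm, abs_of_pos (sub_pos.2 hx.2)] at this
    · rw [h7 x (not_le.1 c1) (not_le.1 c2)]
      simp only [zero_mul, abs_zero]
      positivity
  refine ⟨fun n x => χ n x * k x, max M (2 * C * L + L), fun n => ?_⟩
  obtain ⟨h1, h2, h3, h4, h5, h6, h7⟩ := hχ n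
  refine ⟨h1.mul hk, h2.mul_right, (tsupport_mul_subset_left).trans h3, fun x hx => ?_,
    fun x hx => ?_, fun x hx => ?_, fun x hx => ?_⟩
  · refine le_trans ?_ (le_max_left _ _)
    rw [abs_mul]
    calc |χ n x| * |k x| ≤ 1 * M := by
          gcongr
          · exact h4 x
          · exact hM x ⟨hx.1.le, hx.2.le⟩
      _ = M := one_mul M
  · refine le_trans ?_ (le_max_right _ _)
    rw [hdiff]
    refine (abs_add_le _ _).trans (add_le_add (hbd n x hx) ?_)
    rw [abs_mul]
    calc |χ n x| * |deriv k x| ≤ 1 * L := by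
          gcongr
          · exact h4 x
          · exact hL x ⟨hx.1.le, hx.2.le⟩
      _ = L := one_mul L
  · refine tendsto_const_nhds.congr' ?_
    filter_upwards [eventually_two_div_lt (sub_pos.2 hx.1), eventually_two_div_lt (sub_pos.2 hx.2)]
      with n hn1 hn2
    rw [(hχ n).2.2.2.2.1 x hn1.le hn2.le, one_mul]
  · refine tendsto_const_nhds.congr' ?_
    filter_upwards [eventually_two_div_lt (sub_pos.2 hx.1), eventually_two_div_lt (sub_pos.2 hx.2)]
      with n hn1 hn2
    rw [hdiff, (hχ n).2.2.2.2.1 x hn1.le hn2.le, (hχ n).2.2.2.2.2.2 x hn1 hn2]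
    ring

/-! ### Tensor products as test functions -/

theorem hasFDerivAt_tensor {a b : ℝ → ℝ} (ha : Differentiable ℝ a) (hb : Differentiable ℝ b)
    (p : ℝ × ℝ) : HasFDerivAt (fun p : ℝ × ℝ => a p.1 * b p.2)
      (a p.1 • (deriv b p.2 • ContinuousLinearMap.snd ℝ ℝ ℝ) +
        b p.2 • (deriv a p.1 • ContinuousLinearMap.fst ℝ ℝ ℝ)) p :=
  ((ha p.1).hasDerivAt.comp_hasFDerivAt p hasFDerivAt_fst).mul
    ((hb p.2).hasDerivAt.comp_hasFDerivAt p hasFDerivAt_snd)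

theorem fderiv_tensor_zero {a b : ℝ → ℝ} (ha : Differentiable ℝ a) (hb : Differentiable ℝ b)
    (p : ℝ × ℝ) :
    fderiv ℝ (fun p : ℝ × ℝ => a p.1 * b p.2) p (dir 0) = deriv a p.1 * b p.2 := by
  rw [(hasFDerivAt_tensor ha hb p).fderiv]
  simp [dir, mul_comm]

theorem fderiv_tensor_one {a b : ℝ → ℝ} (ha : Differentiable ℝ a) (hb : Differentiable ℝ b)
    (p : ℝ × ℝ) :
    fderiv ℝ (fun p : ℝ × ℝ => a p.1 * b p.2) p (dir 1) = a p.1 * deriv b p.2 := by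
  rw [(hasFDerivAt_tensor ha hb p).fderiv]
  simp [dir]

theorem contDiff_tensor {a b : ℝ → ℝ} (ha : ContDiff ℝ ∞ a) (hb : ContDiff ℝ ∞ b) :
    ContDiff ℝ ∞ (fun p : ℝ × ℝ => a p.1 * b p.2) :=
  (ha.comp contDiff_fst).mul (hb.comp contDiff_snd)

theorem tsupport_tensor_subset (a b : ℝ → ℝ) :
    tsupport (fun p : ℝ × ℝ => a p.1 * b p.2) ⊆ tsupport a ×ˢ tsupport b := by
  refine closure_minimal (fun p hp => ?_) ((isClosed_tsupport a).prod (isClosed_tsupport b))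
  simp only [Function.mem_support, ne_eq, mul_eq_zero, not_or] at hp
  exact ⟨subset_tsupport a hp.1, subset_tsupport b hp.2⟩

theorem hasCompactSupport_tensor {a b : ℝ → ℝ} (ha : HasCompactSupport a)
    (hb : HasCompactSupport b) : HasCompactSupport (fun p : ℝ × ℝ => a p.1 * b p.2) :=
  (ha.isCompact.prod hb.isCompact).of_isClosed_subset (isClosed_tsupport _)
    (tsupport_tensor_subset a b)

theorem HasWeakPartial.tensor_zero {ℓ : ℝ} {w w' : ℝ × ℝ → ℝ}
    (h : HasWeakPartial (plate ℓ) 0 w w') {a b : ℝ → ℝ} (ha : ContDiff ℝ ∞ a)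
    (ha' : HasCompactSupport a) (ha'' : tsupport a ⊆ Ioo 0 Real.pi) (hb : ContDiff ℝ ∞ b)
    (hb' : HasCompactSupport b) (hb'' : tsupport b ⊆ Ioo (-ℓ) ℓ) :
    ∫ p in plate ℓ, w p * (deriv a p.1 * b p.2) = -∫ p in plate ℓ, w' p * (a p.1 * b p.2) := by
  rw [← h.2.2 _ (contDiff_tensor ha hb) (hasCompactSupport_tensor ha' hb')
    ((tsupport_tensor_subset a b).trans (prod_mono ha'' hb''))]
  simp_rw [fderiv_tensor_zero (ha.differentiable (by simp)) (hb.differentiable (by simp))]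

theorem HasWeakPartial.tensor_one {ℓ : ℝ} {w w' : ℝ × ℝ → ℝ}
    (h : HasWeakPartial (plate ℓ) 1 w w') {a b : ℝ → ℝ} (ha : ContDiff ℝ ∞ a)
    (ha' : HasCompactSupport a) (ha'' : tsupport a ⊆ Ioo 0 Real.pi) (hb : ContDiff ℝ ∞ b)
    (hb' : HasCompactSupport b) (hb'' : tsupport b ⊆ Ioo (-ℓ) ℓ) :
    ∫ p in plate ℓ, w p * (a p.1 * deriv b p.2) = -∫ p in plate ℓ, w' p * (a p.1 * b p.2) := by
  rw [← h.2.2 _ (contDiff_tensor ha hb) (hasCompactSupport_tensor ha' hb')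
    ((tsupport_tensor_subset a b).trans (prod_mono ha'' hb''))]
  simp_rw [fderiv_tensor_one (ha.differentiable (by simp)) (hb.differentiable (by simp))]

/-! ### Integration by parts up to the boundary of the plate -/

theorem measurableSet_plate (ℓ : ℝ) : MeasurableSet (plate ℓ) :=
  measurableSet_Ioo.prod measurableSet_Ioo

theorem isOpen_plate (ℓ : ℝ) : IsOpen (plate ℓ) := isOpen_Ioo.prod isOpen_Ioo

theorem plate_subset_closedPlate (ℓ : ℝ) : plate ℓ ⊆ closedPlate ℓ :=
  prod_mono Ioo_subset_Icc_self Ioo_subset_Icc_self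

theorem isCompact_closedPlate (ℓ : ℝ) : IsCompact (closedPlate ℓ) :=
  isCompact_Icc.prod isCompact_Icc

theorem volume_closedPlate_lt_top (ℓ : ℝ) : volume (closedPlate ℓ) < ⊤ :=
  (isCompact_closedPlate ℓ).measure_lt_top

theorem volume_plate_lt_top (ℓ : ℝ) : volume (plate ℓ) < ⊤ :=
  (measure_mono (plate_subset_closedPlate ℓ)).trans_lt (volume_closedPlate_lt_top ℓ)

instance isFiniteMeasure_plate (ℓ : ℝ) : IsFiniteMeasure (volume.restrict (plate ℓ)) :=
  ⟨by simpa using volume_plate_lt_top ℓ⟩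

theorem integrableOn_mul_continuous {ℓ : ℝ} {v F : ℝ × ℝ → ℝ} (hv : IntegrableOn v (plate ℓ))
    (hF : Continuous F) : IntegrableOn (fun p => v p * F p) (plate ℓ) := by
  obtain ⟨K, hK⟩ := (isCompact_closedPlate ℓ).exists_bound_of_continuousOn hF.continuousOn
  refine Integrable.mul_bdd (c := K) hv hF.aestronglyMeasurable ?_
  filter_upwards [ae_restrict_mem (measurableSet_plate ℓ)] with p hp
  exact hK p (plate_subset_closedPlate ℓ hp)

/-- Dominated convergence with majorant `|w| M`. Bounded pointwise convergence of the test functions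
is thus enough to pass to the limit in a weak identity; no convergence in a Sobolev norm is needed.
-/
theorem tendsto_integral_mul_of_bounded {ℓ : ℝ} {w : ℝ × ℝ → ℝ} (hw : IntegrableOn w (plate ℓ))
    {F : ℕ → ℝ × ℝ → ℝ} {G : ℝ × ℝ → ℝ} {M : ℝ} (hF : ∀ n, Continuous (F n))
    (hM : ∀ n, ∀ p ∈ plate ℓ, |F n p| ≤ M)
    (hlim : ∀ p ∈ plate ℓ, Tendsto (fun n => F n p) atTop (𝓝 (G p))) :
    Tendsto (fun n => ∫ p in plate ℓ, w p * F n p) atTop (𝓝 (∫ p in plate ℓ, w p * G p)) := by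
  refine tendsto_integral_of_dominated_convergence (fun p => |w p| * M)
    (fun n => hw.aestronglyMeasurable.mul (hF n).aestronglyMeasurable)
    (hw.abs.mul_const M) (fun n => ?_) ?_
  · filter_upwards [ae_restrict_mem (measurableSet_plate ℓ)] with p hp
    rw [Real.norm_eq_abs, abs_mul]
    exact mul_le_mul_of_nonneg_left (hM n p hp) (abs_nonneg _)
  · filter_upwards [ae_restrict_mem (measurableSet_plate ℓ)] with p hp
    exact (hlim p hp).const_mul (w p)

theorem abs_mul_le_of_le {x y M N : ℝ} (hx : |x| ≤ M) (hy : |y| ≤ N) : |x * y| ≤ M * N := by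
  rw [abs_mul]
  exact mul_le_mul hx hy (abs_nonneg _) ((abs_nonneg _).trans hx)

/-- Continuity of `deriv` for smooth functions of one variable. -/
theorem continuous_deriv_of_smooth {a : ℝ → ℝ} (ha : ContDiff ℝ ∞ a) : Continuous (deriv a) :=
  (ha.of_le (m := 1) (by simp)).continuous_deriv le_rfl

theorem contDiff_deriv_of_smooth {a : ℝ → ℝ} (ha : ContDiff ℝ ∞ a) : ContDiff ℝ ∞ (deriv a) :=
  (contDiff_infty_iff_deriv.1 ha).2

/-- Weak integration by parts in `x` against `a(x) b(y)` with `a` vanishing at the end points. -/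
theorem HasWeakPartial.integral_zero {ℓ : ℝ} {w w' : ℝ × ℝ → ℝ}
    (h : HasWeakPartial (plate ℓ) 0 w w') (hw : IntegrableOn w (plate ℓ))
    (hw' : IntegrableOn w' (plate ℓ)) {a b : ℝ → ℝ} (ha : ContDiff ℝ ∞ a)
    (ha0 : a 0 = 0) (haπ : a Real.pi = 0) (hb : ContDiff ℝ ∞ b) :
    ∫ p in plate ℓ, w p * (deriv a p.1 * b p.2) = -∫ p in plate ℓ, w' p * (a p.1 * b p.2) := by
  obtain ⟨φ, M, hφ⟩ := exists_testFunction_approx_deriv ha ha0 haπ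
  obtain ⟨ψ, N, hψ⟩ := exists_testFunction_approx hb (-ℓ) ℓ
  have e : ∀ n, ∫ p in plate ℓ, w p * (deriv (φ n) p.1 * ψ n p.2) =
      -∫ p in plate ℓ, w' p * (φ n p.1 * ψ n p.2) := fun n =>
    h.tensor_zero (hφ n).1 (hφ n).2.1 (hφ n).2.2.1 (hψ n).1 (hψ n).2.1 (hψ n).2.2.1
  have t1 := tendsto_integral_mul_of_bounded hw
    (F := fun n p => deriv (φ n) p.1 * ψ n p.2) (G := fun p => deriv a p.1 * b p.2) (M := M * N)
    (fun n => ((continuous_deriv_of_smooth (hφ n).1).comp continuous_fst).mul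
      ((hψ n).1.continuous.comp continuous_snd))
    (fun n p hp => abs_mul_le_of_le ((hφ n).2.2.2.2.1 _ hp.1) ((hψ n).2.2.2.1 _ hp.2))
    -- The limit clauses do not depend on the outer index, so the index `0` is an arbitrary choice.
    (fun p hp => ((hφ 0).2.2.2.2.2.2 _ hp.1).mul ((hψ 0).2.2.2.2 _ hp.2))
  have t2 := tendsto_integral_mul_of_bounded hw'
    (F := fun n p => φ n p.1 * ψ n p.2) (G := fun p => a p.1 * b p.2) (M := M * N)
    (fun n => ((hφ n).1.continuous.comp continuous_fst).mul
      ((hψ n).1.continuous.comp continuous_snd))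
    (fun n p hp => abs_mul_le_of_le ((hφ n).2.2.2.1 _ hp.1) ((hψ n).2.2.2.1 _ hp.2))
    (fun p hp => ((hφ 0).2.2.2.2.2.1 _ hp.1).mul ((hψ 0).2.2.2.2 _ hp.2))
  simp_rw [e] at t1
  exact tendsto_nhds_unique t1 t2.neg

/-- Weak integration by parts in `y` against `a(x) b(y)` with `b` vanishing at the end points. -/
theorem HasWeakPartial.integral_one {ℓ : ℝ} {w w' : ℝ × ℝ → ℝ}
    (h : HasWeakPartial (plate ℓ) 1 w w') (hw : IntegrableOn w (plate ℓ))
    (hw' : IntegrableOn w' (plate ℓ)) {a b : ℝ → ℝ} (ha : ContDiff ℝ ∞ a)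
    (hb : ContDiff ℝ ∞ b) (hb0 : b (-ℓ) = 0) (hb1 : b ℓ = 0) :
    ∫ p in plate ℓ, w p * (a p.1 * deriv b p.2) = -∫ p in plate ℓ, w' p * (a p.1 * b p.2) := by
  obtain ⟨φ, M, hφ⟩ := exists_testFunction_approx_deriv hb hb0 hb1
  obtain ⟨ψ, N, hψ⟩ := exists_testFunction_approx ha 0 Real.pi
  have e : ∀ n, ∫ p in plate ℓ, w p * (ψ n p.1 * deriv (φ n) p.2) =
      -∫ p in plate ℓ, w' p * (ψ n p.1 * φ n p.2) := fun n =>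
    h.tensor_one (hψ n).1 (hψ n).2.1 (hψ n).2.2.1 (hφ n).1 (hφ n).2.1 (hφ n).2.2.1
  have t1 := tendsto_integral_mul_of_bounded hw
    (F := fun n p => ψ n p.1 * deriv (φ n) p.2) (G := fun p => a p.1 * deriv b p.2) (M := N * M)
    (fun n => ((hψ n).1.continuous.comp continuous_fst).mul
      ((continuous_deriv_of_smooth (hφ n).1).comp continuous_snd))
    (fun n p hp => abs_mul_le_of_le ((hψ n).2.2.2.1 _ hp.1) ((hφ n).2.2.2.2.1 _ hp.2))
    (fun p hp => ((hψ 0).2.2.2.2 _ hp.1).mul ((hφ 0).2.2.2.2.2.2 _ hp.2))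
  have t2 := tendsto_integral_mul_of_bounded hw'
    (F := fun n p => ψ n p.1 * φ n p.2) (G := fun p => a p.1 * b p.2) (M := N * M)
    (fun n => ((hψ n).1.continuous.comp continuous_fst).mul
      ((hφ n).1.continuous.comp continuous_snd))
    (fun n p hp => abs_mul_le_of_le ((hψ n).2.2.2.1 _ hp.1) ((hφ n).2.2.2.1 _ hp.2))
    (fun p hp => ((hψ 0).2.2.2.2 _ hp.1).mul ((hφ 0).2.2.2.2.2.1 _ hp.2))
  simp_rw [e] at t1
  exact tendsto_nhds_unique t1 t2.neg

theorem measureReal_layer_le {ℓ r : ℝ} (hℓ : 0 ≤ ℓ) (hr : 0 ≤ r) :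
    volume.real (plate ℓ ∩ {p | p.1 ≤ r ∨ Real.pi - p.1 ≤ r}) ≤ 4 * ℓ * r := by
  have hsub : plate ℓ ∩ {p | p.1 ≤ r ∨ Real.pi - p.1 ≤ r} ⊆
      Icc 0 r ×ˢ Icc (-ℓ) ℓ ∪ Icc (Real.pi - r) Real.pi ×ˢ Icc (-ℓ) ℓ := by
    rintro p ⟨⟨h1, h2⟩, h3 | h3⟩
    · exact Or.inl ⟨⟨h1.1.le, h3⟩, h2.1.le, h2.2.le⟩
    · exact Or.inr ⟨⟨by linarith, h1.2.le⟩, h2.1.le, h2.2.le⟩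
  have hfin : volume (Icc 0 r ×ˢ Icc (-ℓ) ℓ ∪ Icc (Real.pi - r) Real.pi ×ˢ Icc (-ℓ) ℓ) ≠ ⊤ :=
    ((isCompact_Icc.prod isCompact_Icc).union (isCompact_Icc.prod isCompact_Icc)).measure_lt_top.ne
  refine (measureReal_mono hsub hfin).trans ((measureReal_union_le _ _).trans ?_)
  rw [Measure.volume_eq_prod, measureReal_prod_prod, measureReal_prod_prod,
    Real.volume_real_Icc_of_le (by linarith), Real.volume_real_Icc_of_le (by linarith),
    Real.volume_real_Icc_of_le (by linarith)]
  apply le_of_eq; ring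

/-- A function continuous on the closed plate and vanishing on the hinged edges is uniformly small
near them. -/
theorem exists_layer_small {ℓ : ℝ} {w : ℝ × ℝ → ℝ} (hc : ContinuousOn w (closedPlate ℓ))
    (h0 : ∀ y ∈ Ioo (-ℓ) ℓ, w (0, y) = 0 ∧ w (Real.pi, y) = 0) {ε : ℝ} (hε : 0 < ε) :
    ∃ δ > 0, ∀ p ∈ plate ℓ, p.1 < δ ∨ Real.pi - p.1 < δ → |w p| ≤ ε := by
  have hu := (isCompact_closedPlate ℓ).uniformContinuousOn_of_continuous hc
  obtain ⟨δ, hδ, h⟩ := Metric.uniformContinuousOn_iff.1 hu ε hε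
  refine ⟨δ, hδ, fun p hp hpd => ?_⟩
  have hpc := plate_subset_closedPlate ℓ hp
  rcases hpd with hpd | hpd
  · have := h p hpc (0, p.2) ⟨⟨le_rfl, Real.pi_pos.le⟩, hpc.2⟩ (by
      rw [Prod.dist_eq, dist_self, Real.dist_eq]
      simpa [abs_of_pos hp.1.1, hδ] using hpd)
    rw [(h0 _ hp.2).1, Real.dist_eq, sub_zero] at this
    exact this.le
  · have := h p hpc (Real.pi, p.2) ⟨⟨Real.pi_pos.le, le_rfl⟩, hpc.2⟩ (by
      rw [Prod.dist_eq, dist_self, Real.dist_eq, abs_sub_comm, abs_of_pos (sub_pos.2 hp.1.2)]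
      simpa [hδ] using hpd)
    rw [(h0 _ hp.2).2, Real.dist_eq, sub_zero] at this
    exact this.le

/-- Weak integration by parts in `x` against `a(x) b(y)` for functions vanishing on the hinged
edges. -/
theorem HasWeakPartial.integral_zero_of_hinged {ℓ : ℝ} (hℓ : 0 ≤ ℓ) {w w' : ℝ × ℝ → ℝ}
    (h : HasWeakPartial (plate ℓ) 0 w w') (hw : IntegrableOn w (plate ℓ))
    (hw' : IntegrableOn w' (plate ℓ)) (hc : ContinuousOn w (closedPlate ℓ))
    (h0 : ∀ y ∈ Ioo (-ℓ) ℓ, w (0, y) = 0 ∧ w (Real.pi, y) = 0)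
    {a b : ℝ → ℝ} (ha : ContDiff ℝ ∞ a) (hb : ContDiff ℝ ∞ b) :
    ∫ p in plate ℓ, w p * (deriv a p.1 * b p.2) = -∫ p in plate ℓ, w' p * (a p.1 * b p.2) := by
  obtain ⟨χ, C, hC0, hχ⟩ := exists_cutoff 0 Real.pi
  obtain ⟨ψ, N, hψ⟩ := exists_testFunction_approx hb (-ℓ) ℓ
  obtain ⟨M, hM0, hM⟩ := exists_bound_Icc ha.continuous 0 Real.pi
  obtain ⟨M', hM'0, hM'⟩ := exists_bound_Icc (continuous_deriv_of_smooth ha) 0 Real.pi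
  have hχ1 : ∀ x ∈ Ioo 0 Real.pi, Tendsto (fun n => χ n x) atTop (𝓝 1) := fun x hx => by
    refine tendsto_const_nhds.congr' ?_
    filter_upwards [eventually_two_div_lt (sub_pos.2 hx.1),
      eventually_two_div_lt (sub_pos.2 hx.2)] with n hn1 hn2
    rw [(hχ n).2.2.2.2.1 x hn1.le hn2.le]
  have hχd : ∀ n x, deriv (fun x => χ n x * a x) x = deriv (χ n) x * a x + χ n x * deriv a x :=
    fun n x => deriv_fun_mul ((hχ n).1.differentiable (by simp) x) (ha.differentiable (by simp) x)
  have hab : ∀ x, |x| ≤ (1 : ℝ) → ∀ y, ∀ z, |y| ≤ z → |x * y| ≤ z := fun x hx y z hy => by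
    simpa using abs_mul_le_of_le hx hy
  -- The weak identity tested with `χ n * a` times `ψ n`, solved for the term that carries the
  -- derivative of the cutoff.
  have e : ∀ n, ∫ p in plate ℓ, w p * (deriv (χ n) p.1 * a p.1 * ψ n p.2) =
      -(∫ p in plate ℓ, w' p * (χ n p.1 * a p.1 * ψ n p.2)) -
        ∫ p in plate ℓ, w p * (χ n p.1 * deriv a p.1 * ψ n p.2) := by
    intro n
    have c1 := (hχ n).1.continuous
    have c2 := continuous_deriv_of_smooth (hχ n).1
    have c3 := continuous_deriv_of_smooth ha
    have c4 := ha.continuous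
    have c5 := (hψ n).1.continuous
    rw [← h.tensor_zero (a := fun x => χ n x * a x) ((hχ n).1.mul ha) ((hχ n).2.1.mul_right)
      (tsupport_mul_subset_left.trans (hχ n).2.2.1) (hψ n).1 (hψ n).2.1 (hψ n).2.2.1,
      ← integral_sub (integrableOn_mul_continuous hw (by rw [funext (hχd n)]; fun_prop))
        (integrableOn_mul_continuous hw (by fun_prop))]
    congr 1 with p
    rw [hχd]
    ring
  have t1 := tendsto_integral_mul_of_bounded hw
    (F := fun n p => χ n p.1 * deriv a p.1 * ψ n p.2) (G := fun p => 1 * deriv a p.1 * b p.2)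
    (M := M' * N)
    (fun n => (((hχ n).1.continuous.comp continuous_fst).mul
      ((continuous_deriv_of_smooth ha).comp continuous_fst)).mul
      ((hψ n).1.continuous.comp continuous_snd))
    (fun n p hp => abs_mul_le_of_le
      (hab _ ((hχ n).2.2.2.1 _) _ _ (hM' _ (Ioo_subset_Icc_self hp.1))) ((hψ n).2.2.2.1 _ hp.2))
    (fun p hp => ((hχ1 _ hp.1).mul_const _).mul ((hψ 0).2.2.2.2 _ hp.2))
  have t2 := tendsto_integral_mul_of_bounded hw'
    (F := fun n p => χ n p.1 * a p.1 * ψ n p.2) (G := fun p => 1 * a p.1 * b p.2)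
    (M := M * N)
    (fun n => (((hχ n).1.continuous.comp continuous_fst).mul
      (ha.continuous.comp continuous_fst)).mul
      ((hψ n).1.continuous.comp continuous_snd))
    (fun n p hp => abs_mul_le_of_le
      (hab _ ((hχ n).2.2.2.1 _) _ _ (hM _ (Ioo_subset_Icc_self hp.1))) ((hψ n).2.2.2.1 _ hp.2))
    (fun p hp => ((hχ1 _ hp.1).mul_const _).mul ((hψ 0).2.2.2.2 _ hp.2))
  -- Here the hinged condition enters: the cutoff derivative is `O(n)` on a layer of measure
  -- `O(1/n)`, and `w` is uniformly small on that layer.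
  have t3 : Tendsto (fun n => ∫ p in plate ℓ, w p * (deriv (χ n) p.1 * a p.1 * ψ n p.2)) atTop
      (𝓝 0) := by
    have hN0 : 0 ≤ |N| := abs_nonneg _
    rw [Metric.tendsto_atTop']
    intro ε hε
    -- The factor `8 * ℓ` is `(n + 1) * (4 * ℓ * (2 / (n + 1)))`; the summand `1` makes `K`
    -- positive.
    set K := C * M * |N| * (8 * ℓ) + 1 with hK
    have hKpos : 0 < K := by positivity
    obtain ⟨δ, hδ, hsmall⟩ := exists_layer_small hc h0 (ε := ε / (2 * K)) (by positivity)
    obtain ⟨n₀, hn₀⟩ := eventually_atTop.1 (eventually_two_div_lt hδ)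
    refine ⟨n₀, fun n hn => ?_⟩
    have hnδ := hn₀ n hn.le
    have hn1 : (0 : ℝ) < n + 1 := by positivity
    rw [dist_zero_right]
    have hzero : ∀ p ∈ plate ℓ \
        (plate ℓ ∩ {p | p.1 ≤ 2 / (n + 1 : ℝ) ∨ Real.pi - p.1 ≤ 2 / (n + 1 : ℝ)}),
        w p * (deriv (χ n) p.1 * a p.1 * ψ n p.2) = 0 := by
      rintro p ⟨hp, hp'⟩
      have : ¬ (p.1 ≤ 2 / (n + 1 : ℝ) ∨ Real.pi - p.1 ≤ 2 / (n + 1 : ℝ)) := fun h => hp' ⟨hp, h⟩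
      push Not at this
      rw [(hχ n).2.2.2.2.2.2 p.1 (by linarith [this.1]) this.2]
      ring
    rw [setIntegral_eq_of_subset_of_forall_sdiff_eq_zero (measurableSet_plate ℓ)
      inter_subset_left hzero]
    have hbound : ∀ p ∈ plate ℓ ∩ {p | p.1 ≤ 2 / (n + 1 : ℝ) ∨ Real.pi - p.1 ≤ 2 / (n + 1 : ℝ)},
        ‖w p * (deriv (χ n) p.1 * a p.1 * ψ n p.2)‖ ≤ ε / (2 * K) * (C * (n + 1) * M * |N|) := by
      rintro p ⟨hp, hp'⟩
      refine abs_mul_le_of_le (hsmall p hp (hp'.imp (fun h => h.trans_lt hnδ)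
        (fun h => h.trans_lt hnδ))) (abs_mul_le_of_le (abs_mul_le_of_le ((hχ n).2.2.2.2.2.1 _)
          (hM _ (Ioo_subset_Icc_self hp.1))) (((hψ n).2.2.2.1 _ hp.2).trans (le_abs_self _)))
    refine (norm_setIntegral_le_of_norm_le_const
      ((measure_mono inter_subset_left).trans_lt (volume_plate_lt_top ℓ)) hbound).trans_lt ?_
    calc _ ≤ ε / (2 * K) * (C * (n + 1) * M * |N|) * (4 * ℓ * (2 / (n + 1 : ℝ))) := by
          gcongr
          exact measureReal_layer_le hℓ (by positivity)
      _ = ε / (2 * K) * (K - 1) := by rw [hK]; field_simp; ring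
      _ < ε / (2 * K) * (2 * K) := by gcongr; linarith
      _ = ε := by field_simp
  simp_rw [e] at t3
  have := tendsto_nhds_unique t3 (t2.neg.sub t1)
  simp only [one_mul] at this
  linarith

/-! ### Weak partial derivatives -/

theorem locallyIntegrableOn_mul_testFunction {Ω : Set (ℝ × ℝ)} (hΩ : MeasurableSet Ω)
    {g φ : ℝ × ℝ → ℝ} (hg : LocallyIntegrableOn g Ω) (hφ : Continuous φ)
    (hc : HasCompactSupport φ) (hs : tsupport φ ⊆ Ω) :
    IntegrableOn (fun p => g p * φ p) Ω := by
  have h1 : IntegrableOn g (tsupport φ) := hg.integrableOn_compact_subset hs hc.isCompact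
  have h2 : IntegrableOn (fun p => g p * φ p) (tsupport φ) := h1.mul_continuousOn hφ.continuousOn
    hc.isCompact
  refine h2.of_forall_sdiff_eq_zero hΩ fun p hp => ?_
  rw [image_eq_zero_of_notMem_tsupport hp.2, mul_zero]

/-- The fundamental lemma of the calculus of variations applied to `g - g'`. It allows the chosen
`weakPartial` to be replaced by any explicit weak derivative. -/
theorem HasWeakPartial.ae_eq {Ω : Set (ℝ × ℝ)} (hΩ : IsOpen Ω) {i : Fin 2} {u g g' : ℝ × ℝ → ℝ}
    (h : HasWeakPartial Ω i u g) (h' : HasWeakPartial Ω i u g') : g =ᵐ[volume.restrict Ω] g' := by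
  have key := hΩ.ae_eq_zero_of_integral_contDiff_smul_eq_zero (h.2.1.sub h'.2.1)
    (fun φ hφ hc hs => ?_)
  · rw [EventuallyEq, ae_restrict_iff' hΩ.measurableSet]
    filter_upwards [key] with p hp hpΩ
    exact sub_eq_zero.1 (hp hpΩ)
  · have e := (h.2.2 φ hφ hc hs).symm.trans (h'.2.2 φ hφ hc hs)
    rw [neg_inj] at e
    rw [← setIntegral_eq_integral_of_forall_compl_eq_zero (s := Ω) (fun p hp => by
      rw [image_eq_zero_of_notMem_tsupport (fun h => hp (hs h)), zero_smul])]
    have i1 := locallyIntegrableOn_mul_testFunction hΩ.measurableSet h.2.1 hφ.continuous hc hs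
    have i2 := locallyIntegrableOn_mul_testFunction hΩ.measurableSet h'.2.1 hφ.continuous hc hs
    rw [← sub_eq_zero, ← integral_sub i1 i2] at e
    rw [← e]
    congr 1 with p
    simp only [smul_eq_mul, Pi.sub_apply]
    ring

theorem HasWeakPartial.congr {Ω : Set (ℝ × ℝ)} {i : Fin 2}
    {u u' g : ℝ × ℝ → ℝ} (h : HasWeakPartial Ω i u g) (hu : u =ᵐ[volume.restrict Ω] u') :
    HasWeakPartial Ω i u' g := by
  refine ⟨h.1.congr hu, h.2.1, fun φ h1 h2 h3 => ?_⟩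
  rw [← h.2.2 φ h1 h2 h3]
  refine integral_congr_ae ?_
  filter_upwards [hu] with p hp
  rw [hp]

theorem continuous_fderiv_apply_dir {φ : ℝ × ℝ → ℝ} (h : ContDiff ℝ ∞ φ) (i : Fin 2) :
    Continuous fun p => fderiv ℝ φ p (dir i) :=
  (h.continuous_fderiv (by simp)).clm_apply continuous_const

theorem tsupport_fderiv_apply_dir_subset (φ : ℝ × ℝ → ℝ) (i : Fin 2) :
    tsupport (fun p => fderiv ℝ φ p (dir i)) ⊆ tsupport φ :=
  tsupport_fderiv_apply_subset ℝ (dir i)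

theorem hasCompactSupport_fderiv_apply_dir {φ : ℝ × ℝ → ℝ} (h : HasCompactSupport φ)
    (i : Fin 2) : HasCompactSupport fun p => fderiv ℝ φ p (dir i) :=
  h.fderiv_apply ℝ (dir i)

theorem HasWeakPartial.sub {Ω : Set (ℝ × ℝ)} (hΩ : IsOpen Ω) {i : Fin 2}
    {u u' g g' : ℝ × ℝ → ℝ} (h : HasWeakPartial Ω i u g) (h' : HasWeakPartial Ω i u' g') :
    HasWeakPartial Ω i (u - u') (g - g') := by
  refine ⟨h.1.sub h'.1, h.2.1.sub h'.2.1, fun φ h1 h2 h3 => ?_⟩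
  have a1 := locallyIntegrableOn_mul_testFunction hΩ.measurableSet h.2.1 h1.continuous h2 h3
  have a2 := locallyIntegrableOn_mul_testFunction hΩ.measurableSet h'.2.1 h1.continuous h2 h3
  have hsub := (tsupport_fderiv_apply_dir_subset φ i).trans h3
  have b1 := locallyIntegrableOn_mul_testFunction hΩ.measurableSet h.1
    (continuous_fderiv_apply_dir h1 i) (hasCompactSupport_fderiv_apply_dir h2 i) hsub
  have b2 := locallyIntegrableOn_mul_testFunction hΩ.measurableSet h'.1
    (continuous_fderiv_apply_dir h1 i) (hasCompactSupport_fderiv_apply_dir h2 i) hsub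
  simp only [Pi.sub_apply, sub_mul]
  rw [integral_sub b1 b2, integral_sub a1 a2, h.2.2 φ h1 h2 h3, h'.2.2 φ h1 h2 h3]
  ring

theorem weakPartial_spec {Ω : Set (ℝ × ℝ)} {i : Fin 2} {u : ℝ × ℝ → ℝ}
    (h : ∃ g, HasWeakPartial Ω i u g) : HasWeakPartial Ω i u (weakPartial Ω i u) := by
  rw [weakPartial, dif_pos h]
  exact h.choose_spec

theorem HasWeakPartial.weakPartial_ae_eq {Ω : Set (ℝ × ℝ)} (hΩ : IsOpen Ω) {i : Fin 2}
    {u g : ℝ × ℝ → ℝ} (h : HasWeakPartial Ω i u g) :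
    weakPartial Ω i u =ᵐ[volume.restrict Ω] g :=
  (weakPartial_spec ⟨g, h⟩).ae_eq hΩ h

theorem memH1_of_hasWeakPartial {Ω : Set (ℝ × ℝ)} (hΩ : IsOpen Ω) {u : ℝ × ℝ → ℝ}
    {g : Fin 2 → ℝ × ℝ → ℝ} (hu : MemLp u 2 (volume.restrict Ω))
    (hg : ∀ i, HasWeakPartial Ω i u (g i)) (hg' : ∀ i, MemLp (g i) 2 (volume.restrict Ω)) :
    MemH1 Ω u :=
  ⟨hu, fun i => ⟨⟨g i, hg i⟩, (hg' i).ae_eq ((hg i).weakPartial_ae_eq hΩ).symm⟩⟩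

/-- The chosen first derivatives agree almost everywhere with the exhibited `g i`, and being a weak
derivative is insensitive to null sets, so the chosen second derivatives can be read off from the
exhibited ones. -/
theorem memH2_of_hasWeakPartial {Ω : Set (ℝ × ℝ)} (hΩ : IsOpen Ω) {u : ℝ × ℝ → ℝ}
    {g : Fin 2 → ℝ × ℝ → ℝ} {h : Fin 2 → Fin 2 → ℝ × ℝ → ℝ}
    (hu : MemLp u 2 (volume.restrict Ω))
    (hg : ∀ i, HasWeakPartial Ω i u (g i)) (hg' : ∀ i, MemLp (g i) 2 (volume.restrict Ω))
    (hh : ∀ i j, HasWeakPartial Ω j (g i) (h i j))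
    (hh' : ∀ i j, MemLp (h i j) 2 (volume.restrict Ω)) :
    MemH2 Ω u ∧
      ∀ i j, weakPartial Ω j (weakPartial Ω i u) =ᵐ[volume.restrict Ω] h i j := by
  have e := fun i => (hg i).weakPartial_ae_eq hΩ
  have e' := fun i j => (hh i j).congr (e i).symm
  exact ⟨⟨memH1_of_hasWeakPartial hΩ hu hg hg', fun i => memH1_of_hasWeakPartial hΩ
    ((hg' i).ae_eq (e i).symm) (e' i) (hh' i)⟩, fun i j => (e' i j).weakPartial_ae_eq hΩ⟩

theorem MemH2.sub {Ω : Set (ℝ × ℝ)} (hΩ : IsOpen Ω) {u v : ℝ × ℝ → ℝ} (hu : MemH2 Ω u)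
    (hv : MemH2 Ω v) : MemH2 Ω (u - v) ∧
      ∀ i j, weakPartial Ω j (weakPartial Ω i (u - v)) =ᵐ[volume.restrict Ω]
        weakPartial Ω j (weakPartial Ω i u) - weakPartial Ω j (weakPartial Ω i v) :=
  memH2_of_hasWeakPartial hΩ
    (g := fun i => weakPartial Ω i u - weakPartial Ω i v)
    (h := fun i j => weakPartial Ω j (weakPartial Ω i u) - weakPartial Ω j (weakPartial Ω i v))
    (hu.1.1.sub hv.1.1)
    (fun i => (weakPartial_spec (hu.1.2 i).1).sub hΩ (weakPartial_spec (hv.1.2 i).1))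
    (fun i => (hu.1.2 i).2.sub (hv.1.2 i).2)
    (fun i j => (weakPartial_spec ((hu.2 i).2 j).1).sub hΩ (weakPartial_spec ((hv.2 i).2 j).1))
    (fun i j => ((hu.2 i).2 j).2.sub ((hv.2 i).2 j).2)

theorem MemH2Star.sub {ℓ : ℝ} {u v : ℝ × ℝ → ℝ} (hu : MemH2Star ℓ u) (hv : MemH2Star ℓ v) :
    MemH2Star ℓ (u - v) where
  memH2 := (hu.memH2.sub (isOpen_plate ℓ) hv.memH2).1
  continuousOn := hu.continuousOn.sub hv.continuousOn
  hinged y hy := by simp [hu.hinged y hy, hv.hinged y hy]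

section MemH2

variable {ℓ : ℝ} {v : ℝ × ℝ → ℝ}

theorem MemH2.integrableOn (h : MemH2 (plate ℓ) v) : IntegrableOn v (plate ℓ) :=
  h.1.1.integrable (by norm_num)

theorem MemH2.integrableOn_weakPartial (h : MemH2 (plate ℓ) v) (i : Fin 2) :
    IntegrableOn (weakPartial (plate ℓ) i v) (plate ℓ) :=
  (h.1.2 i).2.integrable (by norm_num)

theorem MemH2.memLp_weakPartial₂ (h : MemH2 (plate ℓ) v) (i j : Fin 2) :
    MemLp (weakPartial₂ ℓ i j v) 2 (volume.restrict (plate ℓ)) :=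
  ((h.2 i).2 j).2

theorem MemH2.integrableOn_weakPartial₂ (h : MemH2 (plate ℓ) v) (i j : Fin 2) :
    IntegrableOn (weakPartial₂ ℓ i j v) (plate ℓ) :=
  (h.memLp_weakPartial₂ i j).integrable (by norm_num)

theorem MemH2.hasWeakPartial (h : MemH2 (plate ℓ) v) (i : Fin 2) :
    HasWeakPartial (plate ℓ) i v (weakPartial (plate ℓ) i v) :=
  weakPartial_spec (h.1.2 i).1

theorem MemH2.hasWeakPartial₂ (h : MemH2 (plate ℓ) v) (i j : Fin 2) :
    HasWeakPartial (plate ℓ) j (weakPartial (plate ℓ) i v) (weakPartial₂ ℓ i j v) :=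
  weakPartial_spec ((h.2 i).2 j).1

end MemH2

/-! ### Green's formula for a single mode -/

section Green

variable {ℓ : ℝ} {v : ℝ × ℝ → ℝ} (m : ℝ)

theorem contDiff_sin_mul : ContDiff ℝ ∞ fun x : ℝ => Real.sin (m * x) := by fun_prop

theorem contDiff_cos_mul : ContDiff ℝ ∞ fun x : ℝ => Real.cos (m * x) := by fun_prop

theorem deriv_sin_mul : deriv (fun x : ℝ => Real.sin (m * x)) = fun x => m * Real.cos (m * x) := by
  funext x
  have : HasDerivAt (fun x : ℝ => Real.sin (m * x)) (Real.cos (m * x) * m) x := by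
    simpa using ((hasDerivAt_id x).const_mul m).sin
  rw [this.deriv, mul_comm]

theorem deriv_cos_mul :
    deriv (fun x : ℝ => Real.cos (m * x)) = fun x => -m * Real.sin (m * x) := by
  funext x
  have : HasDerivAt (fun x : ℝ => Real.cos (m * x)) (-Real.sin (m * x) * m) x := by
    simpa using ((hasDerivAt_id x).const_mul m).cos
  rw [this.deriv]; ring

/-- The cosine does not vanish at `0`, so the boundary terms disappear only because `v` is zero on
the hinged edges. -/
theorem MemH2Star.integral_dx_mul_cos (hℓ : 0 ≤ ℓ) (hv : MemH2Star ℓ v) {b : ℝ → ℝ}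
    (hb : ContDiff ℝ ∞ b) :
    ∫ p in plate ℓ, weakPartial (plate ℓ) 0 v p * (Real.cos (m * p.1) * b p.2) =
      m * ∫ p in plate ℓ, v p * (Real.sin (m * p.1) * b p.2) := by
  have h := (hv.memH2.hasWeakPartial 0).integral_zero_of_hinged hℓ hv.memH2.integrableOn
    (hv.memH2.integrableOn_weakPartial 0) hv.continuousOn hv.hinged (contDiff_cos_mul m) hb
  rw [deriv_cos_mul] at h
  rw [← neg_eq_iff_eq_neg.2 h, ← integral_const_mul, ← integral_neg]
  congr 1 with p
  ring

/-- In the first integration by parts the sine vanishes at both ends, so no boundary value of `v_x`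
is needed; the second is `integral_dx_mul_cos`. -/
theorem MemH2Star.integral_dxx_mul_sin (hℓ : 0 ≤ ℓ) (hv : MemH2Star ℓ v) {b : ℝ → ℝ}
    (hb : ContDiff ℝ ∞ b) (hm : Real.sin (m * Real.pi) = 0) :
    ∫ p in plate ℓ, weakPartial₂ ℓ 0 0 v p * (Real.sin (m * p.1) * b p.2) =
      -m ^ 2 * ∫ p in plate ℓ, v p * (Real.sin (m * p.1) * b p.2) := by
  have h := (hv.memH2.hasWeakPartial₂ 0 0).integral_zero (hv.memH2.integrableOn_weakPartial 0)
    (hv.memH2.integrableOn_weakPartial₂ 0 0) (contDiff_sin_mul m) (by simp) hm hb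
  rw [deriv_sin_mul] at h
  have h2 := hv.integral_dx_mul_cos m hℓ hb
  have h3 : ∫ p in plate ℓ, weakPartial (plate ℓ) 0 v p * (m * Real.cos (m * p.1) * b p.2) =
      m * ∫ p in plate ℓ, weakPartial (plate ℓ) 0 v p * (Real.cos (m * p.1) * b p.2) := by
    rw [← integral_const_mul]
    congr 1 with p
    ring
  rw [h3, h2] at h
  linear_combination h

/-- A direct integration by parts in `x` would need the trace of `v_y` on the hinged edges. Instead
the `y`-derivative is moved onto `b`, the identity for `v_x` is used with `b'`, and the
`y`-derivative is moved back. -/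
theorem MemH2Star.integral_dxy_mul_cos (hℓ : 0 ≤ ℓ) (hv : MemH2Star ℓ v) {b : ℝ → ℝ}
    (hb : ContDiff ℝ ∞ b) :
    ∫ p in plate ℓ, weakPartial₂ ℓ 0 1 v p * (Real.cos (m * p.1) * b p.2) =
      m * ∫ p in plate ℓ, weakPartial (plate ℓ) 1 v p * (Real.sin (m * p.1) * b p.2) := by
  have key : ∀ b : ℝ → ℝ, ContDiff ℝ ∞ b → b (-ℓ) = 0 → b ℓ = 0 →
      ∫ p in plate ℓ, weakPartial₂ ℓ 0 1 v p * (Real.cos (m * p.1) * b p.2) =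
      m * ∫ p in plate ℓ, weakPartial (plate ℓ) 1 v p * (Real.sin (m * p.1) * b p.2) := by
    intro b hb h0 h1
    have e1 := (hv.memH2.hasWeakPartial₂ 0 1).integral_one (hv.memH2.integrableOn_weakPartial 0)
      (hv.memH2.integrableOn_weakPartial₂ 0 1) (contDiff_cos_mul m) hb h0 h1
    have e2 := (hv.memH2.hasWeakPartial 1).integral_one hv.memH2.integrableOn
      (hv.memH2.integrableOn_weakPartial 1) (contDiff_sin_mul m) hb h0 h1
    have e3 := hv.integral_dx_mul_cos m hℓ (contDiff_deriv_of_smooth hb)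
    rw [e1, e2] at e3
    linear_combination -e3
  -- The final identity contains no derivative of `b`, so approximating `b` itself removes the
  -- condition at `±ℓ`.
  obtain ⟨ψ, N, hψ⟩ := exists_testFunction_approx hb (-ℓ) ℓ
  have hbdry : ∀ n x, x ∉ Ioo (-ℓ) ℓ → ψ n x = 0 := fun n x hx =>
    image_eq_zero_of_notMem_tsupport fun h => hx ((hψ n).2.2.1 h)
  have t1 := tendsto_integral_mul_of_bounded (hv.memH2.integrableOn_weakPartial₂ 0 1)
    (F := fun n p => Real.cos (m * p.1) * ψ n p.2) (G := fun p => Real.cos (m * p.1) * b p.2)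
    (M := 1 * N) (fun n => by have := (hψ n).1.continuous; fun_prop)
    (fun n p hp => abs_mul_le_of_le (Real.abs_cos_le_one _) ((hψ n).2.2.2.1 _ hp.2))
    (fun p hp => ((hψ 0).2.2.2.2 _ hp.2).const_mul _)
  have t2 := tendsto_integral_mul_of_bounded (hv.memH2.integrableOn_weakPartial 1)
    (F := fun n p => Real.sin (m * p.1) * ψ n p.2) (G := fun p => Real.sin (m * p.1) * b p.2)
    (M := 1 * N) (fun n => by have := (hψ n).1.continuous; fun_prop)
    (fun n p hp => abs_mul_le_of_le (Real.abs_sin_le_one _) ((hψ n).2.2.2.1 _ hp.2))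
    (fun p hp => ((hψ 0).2.2.2.2 _ hp.2).const_mul _)
  have e := fun n => key (ψ n) (hψ n).1 (hbdry n _ (by simp)) (hbdry n _ (by simp))
  simp_rw [e] at t1
  exact tendsto_nhds_unique t1 (t2.const_mul m)

/-- Green's formula: for a mode `Y(y) sin(mx)` satisfying the natural boundary conditions at
`y = ±ℓ`, the plate form against `v ∈ H²_*` is the integral of `v` times the bilaplacian of the
mode. -/
theorem MemH2Star.green_mode (hℓ : 0 ≤ ℓ) (hv : MemH2Star ℓ v)
    (hm : Real.sin (m * Real.pi) = 0) (σ : ℝ) {Y₀ Y₁ Y₂ Y₃ Y₄ : ℝ → ℝ}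
    (h₀ : ∀ y, HasDerivAt Y₀ (Y₁ y) y) (h₁ : ∀ y, HasDerivAt Y₁ (Y₂ y) y)
    (h₂ : ∀ y, HasDerivAt Y₂ (Y₃ y) y) (h₃ : ∀ y, HasDerivAt Y₃ (Y₄ y) y)
    (hY : ContDiff ℝ ∞ Y₀)
    (bc : ∀ y, y = -ℓ ∨ y = ℓ →
      Y₂ y - σ * m ^ 2 * Y₀ y = 0 ∧ Y₃ y - (2 - σ) * m ^ 2 * Y₁ y = 0) :
    ∫ p in plate ℓ,
      (weakPartial₂ ℓ 0 0 v p * (Real.sin (m * p.1) * (σ * Y₂ p.2 - m ^ 2 * Y₀ p.2)) +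
        weakPartial₂ ℓ 1 1 v p * (Real.sin (m * p.1) * (Y₂ p.2 - σ * m ^ 2 * Y₀ p.2)) +
        weakPartial₂ ℓ 0 1 v p * (Real.cos (m * p.1) * (2 * (1 - σ) * m * Y₁ p.2))) =
      ∫ p in plate ℓ, v p *
        (Real.sin (m * p.1) * (Y₄ p.2 - 2 * m ^ 2 * Y₂ p.2 + m ^ 4 * Y₀ p.2)) := by
  have d₀ : deriv Y₀ = Y₁ := funext fun y => (h₀ y).deriv
  have d₁ : deriv Y₁ = Y₂ := funext fun y => (h₁ y).deriv
  have d₂ : deriv Y₂ = Y₃ := funext fun y => (h₂ y).deriv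
  have d₃ : deriv Y₃ = Y₄ := funext fun y => (h₃ y).deriv
  have s₁ : ContDiff ℝ ∞ Y₁ := d₀ ▸ contDiff_deriv_of_smooth hY
  have s₂ : ContDiff ℝ ∞ Y₂ := d₁ ▸ contDiff_deriv_of_smooth s₁
  have s₃ : ContDiff ℝ ∞ Y₃ := d₂ ▸ contDiff_deriv_of_smooth s₂
  have s₄ : ContDiff ℝ ∞ Y₄ := d₃ ▸ contDiff_deriv_of_smooth s₃
  have c₀ := hY.continuous
  have c₁ := s₁.continuous
  have c₂ := s₂.continuous
  have c₃ := s₃.continuous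
  have c₄ := s₄.continuous
  have i00 := hv.memH2.integrableOn_weakPartial₂ 0 0
  have i11 := hv.memH2.integrableOn_weakPartial₂ 1 1
  have i01 := hv.memH2.integrableOn_weakPartial₂ 0 1
  have i1 := hv.memH2.integrableOn_weakPartial 1
  have i := hv.memH2.integrableOn
  have e1 := hv.integral_dxx_mul_sin m hℓ (b := fun y => σ * Y₂ y - m ^ 2 * Y₀ y)
    (by fun_prop) hm
  -- The first natural boundary condition is exactly what makes this test function vanish at `±ℓ`;
  -- the second does the same in `e4`.
  have e2 := (hv.memH2.hasWeakPartial₂ 1 1).integral_one i1 i11 (contDiff_sin_mul m)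
    (b := fun y => Y₂ y - σ * m ^ 2 * Y₀ y) (by fun_prop) (bc _ (Or.inl rfl)).1
    (bc _ (Or.inr rfl)).1
  have e3 := hv.integral_dxy_mul_cos m hℓ (b := fun y => 2 * (1 - σ) * m * Y₁ y) (by fun_prop)
  have e4 := (hv.memH2.hasWeakPartial 1).integral_one i i1 (contDiff_sin_mul m)
    (b := fun y => Y₃ y - (2 - σ) * m ^ 2 * Y₁ y) (by fun_prop) (bc _ (Or.inl rfl)).2
    (bc _ (Or.inr rfl)).2
  have k1 : deriv (fun y => Y₂ y - σ * m ^ 2 * Y₀ y) = fun y => Y₃ y - σ * m ^ 2 * Y₁ y :=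
    funext fun y => ((h₂ y).sub ((h₀ y).const_mul _)).deriv
  have k2 : deriv (fun y => Y₃ y - (2 - σ) * m ^ 2 * Y₁ y) =
      fun y => Y₄ y - (2 - σ) * m ^ 2 * Y₂ y :=
    funext fun y => ((h₃ y).sub ((h₁ y).const_mul _)).deriv
  rw [k1] at e2
  rw [k2] at e4
  -- The `v_y` terms left by `v_yy` and `v_xy` combine into the function of the second boundary
  -- condition, since `2 - σ = σ + 2(1 - σ)`.
  have e5 : (∫ p in plate ℓ, weakPartial (plate ℓ) 1 v p *
      (Real.sin (m * p.1) * (Y₃ p.2 - (2 - σ) * m ^ 2 * Y₁ p.2))) =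
      (∫ p in plate ℓ, weakPartial (plate ℓ) 1 v p *
        (Real.sin (m * p.1) * (Y₃ p.2 - σ * m ^ 2 * Y₁ p.2))) -
      m * ∫ p in plate ℓ, weakPartial (plate ℓ) 1 v p *
        (Real.sin (m * p.1) * (2 * (1 - σ) * m * Y₁ p.2)) := by
    rw [← integral_const_mul, ← integral_sub (integrableOn_mul_continuous i1 (by fun_prop))
      ((integrableOn_mul_continuous i1 (by fun_prop)).const_mul m)]
    congr 1 with p
    ring
  have e6 : (∫ p in plate ℓ, v p *
        (Real.sin (m * p.1) * (Y₄ p.2 - 2 * m ^ 2 * Y₂ p.2 + m ^ 4 * Y₀ p.2))) =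
      (∫ p in plate ℓ, v p * (Real.sin (m * p.1) * (Y₄ p.2 - (2 - σ) * m ^ 2 * Y₂ p.2))) -
      m ^ 2 * ∫ p in plate ℓ, v p * (Real.sin (m * p.1) * (σ * Y₂ p.2 - m ^ 2 * Y₀ p.2)) := by
    rw [← integral_const_mul, ← integral_sub (integrableOn_mul_continuous i (by fun_prop))
      ((integrableOn_mul_continuous i (by fun_prop)).const_mul _)]
    congr 1 with p
    ring
  have j1 := integrableOn_mul_continuous i00
    (F := fun p => Real.sin (m * p.1) * (σ * Y₂ p.2 - m ^ 2 * Y₀ p.2)) (by fun_prop)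
  have j2 := integrableOn_mul_continuous i11
    (F := fun p => Real.sin (m * p.1) * (Y₂ p.2 - σ * m ^ 2 * Y₀ p.2)) (by fun_prop)
  have j3 := integrableOn_mul_continuous i01
    (F := fun p => Real.cos (m * p.1) * (2 * (1 - σ) * m * Y₁ p.2)) (by fun_prop)
  refine (integral_add (j1.add j2) j3).trans ?_
  simp only [Pi.add_apply]
  rw [integral_add j1 j2, e6]
  beta_reduce at e2 e4
  linear_combination e1 + e2 + e3 + e5 - e4

end Green

/-! ### Sine series on `(0, π)` -/

theorem integrableOn_mul_continuous_Ioo {h F : ℝ → ℝ} {a b : ℝ} (hh : IntegrableOn h (Ioo a b))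
    (hF : Continuous F) : IntegrableOn (fun x => h x * F x) (Ioo a b) := by
  obtain ⟨K, -, hK⟩ := exists_bound_Icc hF a b
  refine Integrable.mul_bdd (c := K) hh hF.aestronglyMeasurable ?_
  filter_upwards [ae_restrict_mem measurableSet_Ioo] with p hp
  exact hK p (Ioo_subset_Icc_self hp)

/-- The sines `sin(mx)`, `m ≥ 1`, are complete in `L¹(0, π)`. -/
theorem ae_eq_zero_of_integral_mul_sin_eq_zero {h : ℝ → ℝ} (hh : IntegrableOn h (Ioo 0 Real.pi))
    (h0 : ∀ m : ℕ, 1 ≤ m → ∫ x in Ioo 0 Real.pi, h x * Real.sin (m * x) = 0) :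
    h =ᵐ[volume.restrict (Ioo 0 Real.pi)] 0 := by
  -- Induction through `2 sin((j+1)x) cos x = sin((j+2)x) + sin(jx)`. The trivial case `m = 0` is
  -- included because `j = 0` occurs.
  have step1 : ∀ k m : ℕ, ∫ x in Ioo 0 Real.pi, h x * (Real.sin (m * x) * Real.cos x ^ k) = 0 := by
    intro k
    induction k with
    | zero =>
      intro m
      rcases Nat.eq_zero_or_pos m with rfl | hm
      · simp
      · simpa using h0 m hm
    | succ k ih =>
      intro m
      rcases Nat.eq_zero_or_pos m with rfl | hm
      · simp
      · obtain ⟨j, rfl⟩ : ∃ j, m = j + 1 := ⟨m - 1, by omega⟩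
        have e1 := ih (j + 2)
        have e2 := ih j
        have : ∫ x in Ioo 0 Real.pi,
            (h x * (Real.sin ((j + 2 : ℕ) * x) * Real.cos x ^ k) +
              h x * (Real.sin (j * x) * Real.cos x ^ k)) = 0 := by
          rw [integral_add (integrableOn_mul_continuous_Ioo hh (by fun_prop))
            (integrableOn_mul_continuous_Ioo hh (by fun_prop)), e1, e2, add_zero]
        refine Eq.trans ?_ ((integral_const_mul (1 / 2 : ℝ) _).trans ((congrArg _ this).trans
          (mul_zero _)))
        congr 1 with x
        have s1 : Real.sin ((j + 2 : ℕ) * x) = Real.sin ((j + 1 : ℕ) * x) * Real.cos x +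
            Real.cos ((j + 1 : ℕ) * x) * Real.sin x := by
          rw [← Real.sin_add]; congr 1; push_cast; ring
        have s2 : Real.sin (j * x) = Real.sin ((j + 1 : ℕ) * x) * Real.cos x -
            Real.cos ((j + 1 : ℕ) * x) * Real.sin x := by
          rw [← Real.sin_sub]; congr 1; push_cast; ring
        rw [s1, s2]
        ring
  have step2 : ∀ P : Polynomial ℝ,
      ∫ x in Ioo 0 Real.pi, h x * (Real.sin x * P.eval (Real.cos x)) = 0 := by
    intro P
    induction P using Polynomial.induction_on' with
    | add p q hp hq =>
      have : ∫ x in Ioo 0 Real.pi, (h x * (Real.sin x * p.eval (Real.cos x)) +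
          h x * (Real.sin x * q.eval (Real.cos x))) = 0 := by
        rw [integral_add (integrableOn_mul_continuous_Ioo hh (by fun_prop))
            (integrableOn_mul_continuous_Ioo hh (by fun_prop)), hp, hq, add_zero]
      refine Eq.trans ?_ this
      congr 1 with x
      rw [Polynomial.eval_add]; ring
    | monomial n a =>
      refine Eq.trans ?_ ((integral_const_mul a _).trans ((congrArg _ (step1 n 1)).trans
        (mul_zero _)))
      congr 1 with x
      rw [Polynomial.eval_monomial]; simp; ring
  have step3 : ∀ φ : ℝ → ℝ, Continuous φ →
      ∫ x in Ioo 0 Real.pi, h x * (Real.sin x * φ x) = 0 := by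
    intro φ hφ
    set I := ∫ x in Ioo 0 Real.pi, |h x| with hI
    have hI0 : 0 ≤ I := integral_nonneg fun x => abs_nonneg _
    refine abs_eq_zero.1 (le_antisymm (le_of_forall_pos_le_add fun ε hε => ?_) (abs_nonneg _))
    -- Weierstrass approximation in the variable `t = cos x`, which maps `(0, π)` injectively into
    -- `[-1, 1]`.
    obtain ⟨P, hP⟩ := exists_polynomial_near_of_continuousOn (-1) 1 (fun t => φ (Real.arccos t))
      (hφ.comp Real.continuous_arccos).continuousOn (ε / (I + 1)) (by positivity)
    have hP' : ∀ x ∈ Ioo 0 Real.pi, |φ x - P.eval (Real.cos x)| ≤ ε / (I + 1) := fun x hx => by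
      have := hP (Real.cos x) ⟨Real.neg_one_le_cos x, Real.cos_le_one x⟩
      rw [Real.arccos_cos hx.1.le hx.2.le, abs_sub_comm] at this
      exact this.le
    have e : ∫ x in Ioo 0 Real.pi, h x * (Real.sin x * φ x) =
        ∫ x in Ioo 0 Real.pi, h x * (Real.sin x * (φ x - P.eval (Real.cos x))) := by
      refine ((sub_zero _).symm.trans (congrArg _ (step2 P).symm)).trans ?_
      rw [← integral_sub (integrableOn_mul_continuous_Ioo hh (by fun_prop))
          (integrableOn_mul_continuous_Ioo hh (by fun_prop))]
      congr 1 with x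
      ring
    rw [e, zero_add]
    rw [← Real.norm_eq_abs]
    calc _ ≤ ∫ x in Ioo 0 Real.pi, |h x| * (ε / (I + 1)) := by
          refine norm_integral_le_of_norm_le (hh.abs.mul_const _) ?_
          filter_upwards [ae_restrict_mem measurableSet_Ioo] with x hx
          rw [Real.norm_eq_abs, abs_mul]
          gcongr
          simpa using abs_mul_le_of_le (Real.abs_sin_le_one x) (hP' x hx)
      _ = I * (ε / (I + 1)) := by rw [integral_mul_const]
      _ ≤ (I + 1) * (ε / (I + 1)) := by gcongr; linarith
      _ = ε := by field_simp
  -- The identities control `h · sin` only; this suffices because the sine is positive on `(0, π)`.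
  have hint : IntegrableOn (fun x => h x * Real.sin x) (Ioo 0 Real.pi) :=
    integrableOn_mul_continuous_Ioo hh Real.continuous_sin
  have key := isOpen_Ioo.ae_eq_zero_of_integral_contDiff_smul_eq_zero (μ := volume)
    hint.locallyIntegrableOn (fun φ hφ hc hs => ?_)
  · rw [EventuallyEq, ae_restrict_iff' measurableSet_Ioo]
    filter_upwards [key] with x hx hx'
    have := hx hx'
    rcases mul_eq_zero.1 this with h | h
    · exact h
    · exact absurd h (Real.sin_pos_of_pos_of_lt_pi hx'.1 hx'.2).ne'
  · rw [← setIntegral_eq_integral_of_forall_compl_eq_zero (s := Ioo 0 Real.pi) (fun p hp => by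
      rw [image_eq_zero_of_notMem_tsupport (fun h => hp (hs h)), zero_smul])]
    refine Eq.trans ?_ (step3 φ hφ.continuous)
    congr 1 with x
    simp only [smul_eq_mul]; ring

/-! ### The orthonormal sine basis of `L²(0, π)`, Bessel and Parseval. -/

theorem integral_cos_int_mul {k : ℤ} (hk : k ≠ 0) :
    ∫ x in (0 : ℝ)..Real.pi, Real.cos (k * x) = 0 := by
  rw [intervalIntegral.integral_comp_mul_left _ (by exact_mod_cast hk), integral_cos]
  simp

theorem integral_sin_mul_sin_nat (m n : ℕ) :
    ∫ x in Ioo 0 Real.pi, Real.sin ((m + 1 : ℕ) * x) * Real.sin ((n + 1 : ℕ) * x) =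
      if m = n then Real.pi / 2 else 0 := by
  rw [← integral_Ioc_eq_integral_Ioo, ← intervalIntegral.integral_of_le Real.pi_pos.le]
  have e : ∀ x : ℝ, Real.sin ((m + 1 : ℕ) * x) * Real.sin ((n + 1 : ℕ) * x) =
      (1 / 2) * (Real.cos (((m : ℤ) - n : ℤ) * x) - Real.cos (((m : ℤ) + n + 2 : ℤ) * x)) := by
    intro x
    have := Real.two_mul_sin_mul_sin ((m + 1 : ℕ) * x) ((n + 1 : ℕ) * x)
    have a1 : ((m + 1 : ℕ) * x - (n + 1 : ℕ) * x) = ((m : ℤ) - n : ℤ) * x := by push_cast; ring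
    have a2 : ((m + 1 : ℕ) * x + (n + 1 : ℕ) * x) = ((m : ℤ) + n + 2 : ℤ) * x := by
      push_cast; ring
    rw [a1, a2] at this
    linarith
  simp_rw [e]
  rw [intervalIntegral.integral_const_mul, intervalIntegral.integral_sub
    ((by fun_prop : Continuous _).intervalIntegrable _ _)
    ((by fun_prop : Continuous _).intervalIntegrable _ _),
    integral_cos_int_mul (k := (m : ℤ) + n + 2) (by omega)]
  split_ifs with h
  · subst h; simp; ring
  · rw [integral_cos_int_mul (by omega)]; simp

theorem memLp_two_of_continuous {F : ℝ → ℝ} (hF : Continuous F) (a b : ℝ) :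
    MemLp F 2 (volume.restrict (Ioo a b)) := by
  obtain ⟨K, -, hK⟩ := exists_bound_Icc hF a b
  refine MemLp.of_bound hF.aestronglyMeasurable K ?_
  filter_upwards [ae_restrict_mem measurableSet_Ioo] with p hp
  exact hK p (Ioo_subset_Icc_self hp)

/-- The normalized sine `√(2/π) sin((n+1)x)` as an element of `L²(0, π)`. -/
noncomputable def sineLp (n : ℕ) : Lp ℝ 2 (volume.restrict (Ioo 0 Real.pi)) :=
  (memLp_two_of_continuous (F := fun x => √(2 / Real.pi) * Real.sin ((n + 1 : ℕ) * x))
    (by fun_prop) 0 Real.pi).toLp _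

theorem inner_sineLp (n : ℕ) (f : Lp ℝ 2 (volume.restrict (Ioo 0 Real.pi))) :
    inner ℝ (sineLp n) f =
      √(2 / Real.pi) * ∫ x in Ioo 0 Real.pi, f x * Real.sin ((n + 1 : ℕ) * x) := by
  rw [L2.inner_def, ← integral_const_mul]
  refine integral_congr_ae ?_
  filter_upwards [MemLp.coeFn_toLp (memLp_two_of_continuous
    (F := fun x => √(2 / Real.pi) * Real.sin ((n + 1 : ℕ) * x)) (by fun_prop) 0 Real.pi)] with x hx
  rw [sineLp, hx]
  simp only [RCLike.inner_apply, conj_trivial]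
  ring

theorem orthonormal_sineLp : Orthonormal ℝ sineLp := by
  rw [orthonormal_iff_ite]
  intro m n
  rw [inner_sineLp]
  have : ∫ x in Ioo 0 Real.pi, sineLp n x * Real.sin ((m + 1 : ℕ) * x) =
      √(2 / Real.pi) * ∫ x in Ioo 0 Real.pi,
        Real.sin ((m + 1 : ℕ) * x) * Real.sin ((n + 1 : ℕ) * x) := by
    rw [← integral_const_mul]
    refine integral_congr_ae ?_
    filter_upwards [MemLp.coeFn_toLp (memLp_two_of_continuous
      (F := fun x => √(2 / Real.pi) * Real.sin ((n + 1 : ℕ) * x)) (by fun_prop) 0 Real.pi)]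
      with x hx
    rw [sineLp, hx]
    ring
  rw [this, integral_sin_mul_sin_nat, ← mul_assoc, Real.mul_self_sqrt (by positivity)]
  split_ifs
  · field_simp
  · simp

/-- The Hilbert basis of normalized sines. -/
noncomputable def sineBasis : HilbertBasis ℕ ℝ (Lp ℝ 2 (volume.restrict (Ioo 0 Real.pi))) :=
  HilbertBasis.mkOfOrthogonalEqBot orthonormal_sineLp (by
    rw [Submodule.eq_bot_iff]
    intro f hf
    rw [Submodule.mem_orthogonal] at hf
    have hs : 0 < √(2 / Real.pi) := Real.sqrt_pos.2 (by positivity)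
    have : f =ᵐ[volume.restrict (Ioo 0 Real.pi)] 0 := by
      refine ae_eq_zero_of_integral_mul_sin_eq_zero
        ((Lp.memLp f).integrable (by norm_num)) fun m hm => ?_
      obtain ⟨j, rfl⟩ : ∃ j, m = j + 1 := ⟨m - 1, by omega⟩
      have h := hf (sineLp j) (Submodule.subset_span ⟨j, rfl⟩)
      rw [inner_sineLp] at h
      exact (mul_eq_zero.1 h).resolve_left hs.ne'
    exact (Lp.eq_zero_iff_ae_eq_zero).2 this)

theorem sineBasis_apply (n : ℕ) : sineBasis n = sineLp n := by
  rw [sineBasis, HilbertBasis.coe_mkOfOrthogonalEqBot]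

theorem sineCoeff_eq (g : ℝ → ℝ) (m : ℕ) :
    sineCoeff g m = 2 / Real.pi * ∫ x in Ioo 0 Real.pi, g x * Real.sin (m * x) := by
  rw [sineCoeff, intervalIntegral.integral_of_le Real.pi_pos.le, integral_Ioc_eq_integral_Ioo]

theorem inner_sineLp_toLp {g : ℝ → ℝ} (hg : MemLp g 2 (volume.restrict (Ioo 0 Real.pi))) (n : ℕ) :
    inner ℝ (sineLp n) (hg.toLp g) =
      √(2 / Real.pi) * ∫ x in Ioo 0 Real.pi, g x * Real.sin ((n + 1 : ℕ) * x) := by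
  rw [inner_sineLp]
  congr 1
  refine integral_congr_ae ?_
  filter_upwards [hg.coeFn_toLp] with x hx
  rw [hx]

/-- Bessel's inequality for sine coefficients, as summability. -/
theorem summable_sineCoeff_sq {g : ℝ → ℝ} (hg : MemLp g 2 (volume.restrict (Ioo 0 Real.pi))) :
    Summable fun n : ℕ => sineCoeff g (n + 1) ^ 2 := by
  have h := orthonormal_sineLp.inner_products_summable (hg.toLp g)
  refine (h.mul_left (2 / Real.pi)).congr fun n => ?_
  rw [inner_sineLp_toLp, sineCoeff_eq, Real.norm_eq_abs, sq_abs, mul_pow, Real.sq_sqrt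
    (by positivity)]
  ring

/-- Parseval's identity for sine series. -/
theorem hasSum_sineCoeff_mul_integral {g V : ℝ → ℝ}
    (hg : MemLp g 2 (volume.restrict (Ioo 0 Real.pi)))
    (hV : MemLp V 2 (volume.restrict (Ioo 0 Real.pi))) :
    HasSum (fun n : ℕ => sineCoeff g (n + 1) *
      ∫ x in Ioo 0 Real.pi, V x * Real.sin ((n + 1 : ℕ) * x))
      (∫ x in Ioo 0 Real.pi, g x * V x) := by
  have h := sineBasis.hasSum_inner_mul_inner (hg.toLp g) (hV.toLp V)
  have e : inner ℝ (hg.toLp g) (hV.toLp V) = ∫ x in Ioo 0 Real.pi, g x * V x := by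
    rw [L2.inner_def]
    refine integral_congr_ae ?_
    filter_upwards [hg.coeFn_toLp, hV.coeFn_toLp] with x h1 h2
    rw [h1, h2]
    simp only [RCLike.inner_apply, conj_trivial]
    ring
  rw [e] at h
  have hn : ∀ n, inner ℝ (hg.toLp g) (sineBasis n) * inner ℝ (sineBasis n) (hV.toLp V) =
      sineCoeff g (n + 1) * ∫ x in Ioo 0 Real.pi, V x * Real.sin ((n + 1 : ℕ) * x) := fun n => by
    rw [sineBasis_apply, real_inner_comm, inner_sineLp_toLp, inner_sineLp_toLp, sineCoeff_eq]
    nth_rewrite 3 [← Real.mul_self_sqrt (by positivity : 0 ≤ 2 / Real.pi)]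
    ring
  simp_rw [hn] at h
  exact h

/-! ### Modes in the `y` variable -/

/-- The functions `E e^{αy} + A cosh(my) + B sinh(my) + C y cosh(my) + D y sinh(my)`. -/
noncomputable def modeFn (α m E A B C D y : ℝ) : ℝ :=
  E * Real.exp (α * y) + A * Real.cosh (m * y) + B * Real.sinh (m * y)
    + C * y * Real.cosh (m * y) + D * y * Real.sinh (m * y)

/-- The family is closed under differentiation, which acts linearly on the coefficients, so higher
derivatives come from iterating a map on five numbers. -/
theorem hasDerivAt_modeFn (α m E A B C D y : ℝ) :
    HasDerivAt (modeFn α m E A B C D)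
      (modeFn α m (α * E) (m * B + C) (m * A + D) (m * D) (m * C) y) y := by
  have hl : ∀ k : ℝ, HasDerivAt (fun y : ℝ => k * y) k y := fun k => by
    simpa using (hasDerivAt_id y).const_mul k
  have he := (hl α).exp
  have hc := (hl m).cosh
  have hs := (hl m).sinh
  have h := ((((he.const_mul E).add (hc.const_mul A)).add (hs.const_mul B)).add
    ((hl C).mul hc)).add ((hl D).mul hs)
  refine h.congr_deriv ?_
  simp only [modeFn]
  ring

theorem contDiff_modeFn (α m E A B C D : ℝ) : ContDiff ℝ ∞ (modeFn α m E A B C D) := by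
  unfold modeFn
  fun_prop

/-- A bound for the size of a mode on `[-ℓ, ℓ]`. -/
noncomputable def modeSize (ℓ α m E A B C D : ℝ) : ℝ :=
  |E| * Real.exp (α * ℓ) + (|A| + |B| + |C| + |D|) * Real.cosh (m * ℓ)

theorem abs_modeFn_le {ℓ α m y : ℝ} (hα : 0 ≤ α) (hy : |y| ≤ ℓ)
    (E A B C D : ℝ) : |modeFn α m E A B C D y| ≤ (1 + ℓ) * modeSize ℓ α m E A B C D := by
  have hℓ : 0 ≤ ℓ := (abs_nonneg y).trans hy
  have hmy : |m * y| ≤ |m * ℓ| := by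
    rw [abs_mul, abs_mul, abs_of_nonneg hℓ]
    gcongr
  have c1 : |Real.cosh (m * y)| ≤ Real.cosh (m * ℓ) := by
    rw [abs_of_pos (Real.cosh_pos _)]; exact Real.cosh_le_cosh.2 hmy
  have s1 : |Real.sinh (m * y)| ≤ Real.cosh (m * ℓ) := by
    refine le_trans ?_ c1
    rw [← sq_le_sq]
    linarith [Real.cosh_sq (m * y)]
  have e1 : |Real.exp (α * y)| ≤ Real.exp (α * ℓ) := by
    rw [Real.abs_exp]
    gcongr
    exact (le_abs_self y).trans hy
  have t1 := abs_mul_le_of_le (le_refl |E|) e1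
  have t2 := abs_mul_le_of_le (le_refl |A|) c1
  have t3 := abs_mul_le_of_le (le_refl |B|) s1
  have t4 := abs_mul_le_of_le (abs_mul_le_of_le (le_refl |C|) hy) c1
  have t5 := abs_mul_le_of_le (abs_mul_le_of_le (le_refl |D|) hy) s1
  have := Real.cosh_pos (m * ℓ)
  have p1 : 0 ≤ |E| * Real.exp (α * ℓ) := by positivity
  have p2 : 0 ≤ |A| * Real.cosh (m * ℓ) := by positivity
  have p3 : 0 ≤ |B| * Real.cosh (m * ℓ) := by positivity
  have p4 : 0 ≤ |C| * Real.cosh (m * ℓ) := by positivity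
  have p5 : 0 ≤ |D| * Real.cosh (m * ℓ) := by positivity
  unfold modeFn modeSize
  refine (abs_add_le _ _).trans ?_
  refine (add_le_add_left ((abs_add_le _ _).trans (add_le_add_left ((abs_add_le _ _).trans
    (add_le_add_left (abs_add_le _ _) _)) _)) _).trans ?_
  nlinarith [mul_nonneg hℓ p1, mul_nonneg hℓ p2, mul_nonneg hℓ p3]

/-- Each derivative costs one factor of order `m`: `α` pays for the exponential, and `2` for `|C|`
and `|D|`, which enter with weight `m + 1 ≤ 2m`. -/
theorem modeSize_deriv_le {α m : ℝ} (hα : 0 ≤ α) (hm : 1 ≤ m) (ℓ E A B C D : ℝ) :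
    modeSize ℓ α m (α * E) (m * B + C) (m * A + D) (m * D) (m * C) ≤
      (2 + α) * m * modeSize ℓ α m E A B C D := by
  have hc := Real.cosh_pos (m * ℓ)
  have he := Real.exp_pos (α * ℓ)
  have hm0 : 0 ≤ m := by linarith
  have a1 : |m * B + C| ≤ m * |B| + |C| := by
    refine (abs_add_le _ _).trans_eq ?_
    rw [abs_mul, abs_of_nonneg hm0]
  have a2 : |m * A + D| ≤ m * |A| + |D| := by
    refine (abs_add_le _ _).trans_eq ?_
    rw [abs_mul, abs_of_nonneg hm0]
  unfold modeSize
  rw [abs_mul α, abs_mul m D, abs_mul m C, abs_of_nonneg hα, abs_of_nonneg hm0]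
  have h1 : α * |E| * Real.exp (α * ℓ) ≤ (2 + α) * m * (|E| * Real.exp (α * ℓ)) := by
    rw [mul_assoc]
    gcongr
    nlinarith
  have h2 : |m * B + C| + |m * A + D| + m * |D| + m * |C| ≤
      (2 + α) * m * (|A| + |B| + |C| + |D|) := by
    have k1 := mul_nonneg (sub_nonneg.2 hm) (abs_nonneg C)
    have k2 := mul_nonneg (sub_nonneg.2 hm) (abs_nonneg D)
    have k3 : 0 ≤ m * |A| := by positivity
    have k4 : 0 ≤ m * |B| := by positivity
    have k5 : 0 ≤ α * m * (|A| + |B| + |C| + |D|) := by positivity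
    linarith
  calc _ ≤ (2 + α) * m * (|E| * Real.exp (α * ℓ)) +
        (2 + α) * m * (|A| + |B| + |C| + |D|) * Real.cosh (m * ℓ) := by gcongr
    _ = _ := by ring

/-! ### The linear systems -/

theorem existsUnique_cramer {a b c d r s : ℝ} (h : a * d - b * c ≠ 0) :
    ∃! x : ℝ × ℝ, a * x.1 + b * x.2 = r ∧ c * x.1 + d * x.2 = s := by
  refine ⟨((r * d - b * s) / (a * d - b * c), (a * s - c * r) / (a * d - b * c)), ⟨?_, ?_⟩, ?_⟩
  · rw [mul_div_assoc', mul_div_assoc', ← add_div, div_eq_iff h]; ring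
  · rw [mul_div_assoc', mul_div_assoc', ← add_div, div_eq_iff h]; ring
  · rintro ⟨x, y⟩ ⟨h1, h2⟩
    dsimp only at h1 h2
    ext
    · rw [eq_div_iff h]; linear_combination d * h1 - b * h2
    · rw [eq_div_iff h]; linear_combination a * h2 - c * h1

section Systems

variable {ℓ σ : ℝ}

theorem self_le_sinh_mul_cosh {t : ℝ} (ht : 0 ≤ t) : t ≤ Real.sinh t * Real.cosh t := by
  have h1 := Real.self_le_sinh_iff.2 ht
  have h2 := Real.one_le_cosh t
  nlinarith

/-- By `cosh² - sinh² = 1` the determinant is `(1-σ) m⁴ [(3+σ) sinh(mℓ) cosh(mℓ) - (1-σ) mℓ]`,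
positive because `mℓ ≤ sinh(mℓ) cosh(mℓ)`. -/
theorem existsUnique_systemAD (hℓ : 0 < ℓ) (hσ₀ : 0 < σ) (hσ₁ : σ < 1) (α γ : ℝ) {m : ℕ}
    (hm : 1 ≤ m) : ∃! AD : ℝ × ℝ, SystemAD ℓ σ α γ m AD.1 AD.2 := by
  have hm' : (1 : ℝ) ≤ m := by exact_mod_cast hm
  have hsc := self_le_sinh_mul_cosh (t := m * ℓ) (by positivity)
  have hcs := Real.cosh_sq (m * ℓ)
  have ht : 0 < m * ℓ := by positivity
  refine existsUnique_cramer (ne_of_gt ?_)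
  have : 0 < (1 - σ) * (m : ℝ) ^ 4 * ((3 + σ) * (Real.sinh (m * ℓ) * Real.cosh (m * ℓ)) -
      (1 - σ) * (m * ℓ)) := by
    have : 0 < 1 - σ := by linarith
    have : 0 < (3 + σ) * (Real.sinh (m * ℓ) * Real.cosh (m * ℓ)) - (1 - σ) * (m * ℓ) := by
      nlinarith
    positivity
  refine this.trans_eq ?_
  linear_combination -(1 - σ) ^ 2 * (m : ℝ) ^ 5 * ℓ * (-1) * hcs

/-- The determinant is that of the other system with `+(1-σ) mℓ` in the bracket. -/
theorem existsUnique_systemBC (hℓ : 0 < ℓ) (hσ₀ : 0 < σ) (hσ₁ : σ < 1) (α γ : ℝ) {m : ℕ}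
    (hm : 1 ≤ m) : ∃! BC : ℝ × ℝ, SystemBC ℓ σ α γ m BC.1 BC.2 := by
  have hm' : (1 : ℝ) ≤ m := by exact_mod_cast hm
  have hsc := self_le_sinh_mul_cosh (t := m * ℓ) (by positivity)
  have hcs := Real.cosh_sq (m * ℓ)
  have ht : 0 < m * ℓ := by positivity
  refine existsUnique_cramer (ne_of_gt ?_)
  have : 0 < (1 - σ) * (m : ℝ) ^ 4 * ((3 + σ) * (Real.sinh (m * ℓ) * Real.cosh (m * ℓ)) +
      (1 - σ) * (m * ℓ)) := by
    have : 0 < 1 - σ := by linarith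
    have : 0 < Real.sinh (m * ℓ) * Real.cosh (m * ℓ) := by linarith
    positivity
  refine this.trans_eq ?_
  linear_combination (1 - σ) ^ 2 * (m : ℝ) ^ 5 * ℓ * (-1) * hcs

/-- This is `sinh((m-1)ℓ) ≥ 0` expanded. The constant `coth ℓ` is independent of `m`, so `cosh(mℓ)`
and `sinh(mℓ)` are interchangeable in the estimates below. -/
theorem cosh_le_mul_sinh (hℓ : 0 < ℓ) {m : ℝ} (hm : 1 ≤ m) :
    Real.cosh (m * ℓ) ≤ Real.cosh ℓ / Real.sinh ℓ * Real.sinh (m * ℓ) := by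
  have hs := Real.sinh_pos_iff.2 hℓ
  have h := Real.sinh_sub (m * ℓ) ℓ
  have h' : 0 ≤ Real.sinh (m * ℓ - ℓ) := Real.sinh_nonneg_iff.2 (by nlinarith)
  rw [div_mul_eq_mul_div, le_div_iff₀ hs]
  linarith

/-- Here `s` and `c` stand for `sinh(mℓ)` and `cosh(mℓ)`. The combination `m s R₁ + c R₂` eliminates
`A` and leaves a coefficient of `D` that is at least `m² s c`; the first row then bounds `A`. -/
theorem abs_le_of_systemAD {m s c κ A D R₁ R₂ T : ℝ} (hℓ : 0 < ℓ) (hσ₀ : 0 < σ) (hσ₁ : σ < 1)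
    (hm : 1 ≤ m) (hs : 0 < s) (hc : 0 < c) (hcs : c ^ 2 = s ^ 2 + 1) (hsc : m * ℓ ≤ s * c)
    (hκ : c ≤ κ * s) (hle : s ≤ c) (hκ0 : 0 ≤ κ)
    (h₁ : (1 - σ) * m ^ 2 * c * A + m * (2 * c + (1 - σ) * m * ℓ * s) * D = R₁)
    (h₂ : (σ - 1) * m ^ 3 * s * A + m ^ 2 * ((1 + σ) * s + (σ - 1) * m * ℓ * c) * D = R₂)
    (hR₁ : |R₁| ≤ T) (hR₂ : |R₂| ≤ T) :
    |D| * c ≤ (1 + κ) * T / m ∧ |A| * c ≤ (1 + (2 + ℓ) * (1 + κ)) / (1 - σ) * T / m := by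
  have hT : 0 ≤ T := (abs_nonneg _).trans hR₁
  have hm0 : 0 < m := by linarith
  have hσ' : 0 < 1 - σ := by linarith
  have hD : |D| * c ≤ (1 + κ) * T / m := by
    have e : m ^ 2 * ((3 + σ) * (s * c) - (1 - σ) * (m * ℓ)) * D = m * s * R₁ + c * R₂ := by
      rw [← h₁, ← h₂]
      linear_combination m ^ 2 * (1 - σ) * m * ℓ * D * hcs
    have hb : s * c ≤ (3 + σ) * (s * c) - (1 - σ) * (m * ℓ) := by
      have : 0 < s * c := by positivity
      nlinarith
    have hb0 : 0 ≤ (3 + σ) * (s * c) - (1 - σ) * (m * ℓ) := le_trans (by positivity) hb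
    have h3 : m ^ 2 * (s * c) * |D| ≤ m * s * T + κ * s * T := by
      calc m ^ 2 * (s * c) * |D| ≤ m ^ 2 * ((3 + σ) * (s * c) - (1 - σ) * (m * ℓ)) * |D| := by
            gcongr
        _ = |m * s * R₁ + c * R₂| := by
            rw [← e, abs_mul, abs_of_nonneg (mul_nonneg (by positivity) hb0)]
        _ ≤ m * s * T + c * T := by
            refine (abs_add_le _ _).trans ?_
            rw [abs_mul, abs_mul c, abs_of_pos (by positivity : 0 < m * s), abs_of_pos hc]
            gcongr
        _ ≤ _ := by gcongr
    rw [le_div_iff₀ hm0]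
    have h4 : (m * s) * (|D| * c * m) ≤ (m * s) * ((1 + κ) * T) := by
      have : κ * s * T ≤ m * (κ * s * T) := le_mul_of_one_le_left (by positivity) hm
      nlinarith
    exact le_of_mul_le_mul_left h4 (by positivity)
  refine ⟨hD, ?_⟩
  have e : (1 - σ) * m ^ 2 * (c * A) = R₁ - m * (2 * c + (1 - σ) * m * ℓ * s) * D := by
    rw [← h₁]; ring
  have h3 : (1 - σ) * m ^ 2 * (|A| * c) ≤ T + m ^ 2 * (2 + ℓ) * (|D| * c) := by
    calc (1 - σ) * m ^ 2 * (|A| * c) = |(1 - σ) * m ^ 2 * (c * A)| := by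
          rw [abs_mul, abs_of_pos (by positivity : 0 < (1 - σ) * m ^ 2), abs_mul, abs_of_pos hc]
          ring
      _ ≤ T + m * (2 * c + (1 - σ) * m * ℓ * s) * |D| := by
          rw [e]
          refine (abs_sub _ _).trans ?_
          rw [abs_mul (m * _), abs_of_pos (by positivity : 0 < m * (2 * c + (1 - σ) * m * ℓ * s))]
          gcongr
      _ ≤ T + m * (2 * (m * c) + 1 * m * ℓ * c) * |D| := by
          gcongr
          · nlinarith
          · linarith
      _ = _ := by ring
  have h4 : (1 - σ) * m ^ 2 * (|A| * c) ≤ m * (1 + (2 + ℓ) * (1 + κ)) * T := by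
    calc _ ≤ T + m ^ 2 * (2 + ℓ) * ((1 + κ) * T / m) := h3.trans (by gcongr)
      _ = T + m * (2 + ℓ) * (1 + κ) * T := by field_simp
      _ ≤ m * T + m * (2 + ℓ) * (1 + κ) * T := by gcongr; nlinarith
      _ = _ := by ring
  rw [div_mul_eq_mul_div, div_div, le_div_iff₀ (by positivity)]
  have h5 : m * (|A| * c * ((1 - σ) * m)) ≤ m * ((1 + (2 + ℓ) * (1 + κ)) * T) := by linarith
  exact le_of_mul_le_mul_left h5 hm0

/-- The same elimination, with `m c R₁ + s R₂`. The first row now bounds `|B| s`, and passing to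
`|B| c` costs the extra factor `κ`. -/
theorem abs_le_of_systemBC {m s c κ B C R₁ R₂ T : ℝ} (hℓ : 0 < ℓ) (hσ₀ : 0 < σ) (hσ₁ : σ < 1)
    (hm : 1 ≤ m) (hs : 0 < s) (hc : 0 < c) (hcs : c ^ 2 = s ^ 2 + 1)
    (hκ : c ≤ κ * s) (hle : s ≤ c) (hκ0 : 0 ≤ κ)
    (h₁ : (1 - σ) * m ^ 2 * s * B + m * (2 * s + (1 - σ) * m * ℓ * c) * C = R₁)
    (h₂ : (σ - 1) * m ^ 3 * c * B + m ^ 2 * ((1 + σ) * c + (σ - 1) * m * ℓ * s) * C = R₂)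
    (hR₁ : |R₁| ≤ T) (hR₂ : |R₂| ≤ T) :
    |C| * c ≤ κ * (1 + κ) * T / m ∧
      |B| * c ≤ κ * ((1 + (2 + ℓ) * (κ * (1 + κ))) / (1 - σ) * T / m) := by
  have hT : 0 ≤ T := (abs_nonneg _).trans hR₁
  have hm0 : 0 < m := by linarith
  have hσ' : 0 < 1 - σ := by linarith
  have hC : |C| * c ≤ κ * (1 + κ) * T / m := by
    have e : m ^ 2 * ((3 + σ) * (s * c) + (1 - σ) * (m * ℓ)) * C = m * c * R₁ + s * R₂ := by
      rw [← h₁, ← h₂]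
      linear_combination -m ^ 2 * (1 - σ) * m * ℓ * C * hcs
    have hb : s * c ≤ (3 + σ) * (s * c) + (1 - σ) * (m * ℓ) := by
      have : 0 < s * c := by positivity
      have : 0 < (1 - σ) * (m * ℓ) := by positivity
      nlinarith
    have hb0 : 0 ≤ (3 + σ) * (s * c) + (1 - σ) * (m * ℓ) := le_trans (by positivity) hb
    have h3 : m ^ 2 * (s * c) * |C| ≤ m * (κ * s) * T + s * T := by
      calc m ^ 2 * (s * c) * |C| ≤ m ^ 2 * ((3 + σ) * (s * c) + (1 - σ) * (m * ℓ)) * |C| := by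
            gcongr
        _ = |m * c * R₁ + s * R₂| := by
            rw [← e, abs_mul, abs_of_nonneg (mul_nonneg (by positivity) hb0)]
        _ ≤ m * c * T + s * T := by
            refine (abs_add_le _ _).trans ?_
            rw [abs_mul, abs_mul s, abs_of_pos (by positivity : 0 < m * c), abs_of_pos hs]
            gcongr
        _ ≤ _ := by gcongr
    have hκ1 : 1 ≤ κ := by
      by_contra! h
      nlinarith
    rw [le_div_iff₀ hm0]
    have h4 : (m * s) * (|C| * c * m) ≤ (m * s) * (κ * (1 + κ) * T) := by
      have k1 : s * T ≤ m * (s * T) := le_mul_of_one_le_left (by positivity) hm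
      have k2 : m * (s * T) * 1 ≤ m * (s * T) * (κ * κ) := by
        gcongr
        nlinarith
      nlinarith
    exact le_of_mul_le_mul_left h4 (by positivity)
  refine ⟨hC, ?_⟩
  have e : (1 - σ) * m ^ 2 * (s * B) = R₁ - m * (2 * s + (1 - σ) * m * ℓ * c) * C := by
    rw [← h₁]; ring
  have h3 : (1 - σ) * m ^ 2 * (|B| * s) ≤ T + m ^ 2 * (2 + ℓ) * (|C| * c) := by
    calc (1 - σ) * m ^ 2 * (|B| * s) = |(1 - σ) * m ^ 2 * (s * B)| := by
          rw [abs_mul, abs_of_pos (by positivity : 0 < (1 - σ) * m ^ 2), abs_mul, abs_of_pos hs]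
          ring
      _ ≤ T + m * (2 * s + (1 - σ) * m * ℓ * c) * |C| := by
          rw [e]
          refine (abs_sub _ _).trans ?_
          rw [abs_mul (m * _), abs_of_pos (by positivity : 0 < m * (2 * s + (1 - σ) * m * ℓ * c))]
          gcongr
      _ ≤ T + m * (2 * (m * c) + 1 * m * ℓ * c) * |C| := by
          gcongr
          · nlinarith
          · linarith
      _ = _ := by ring
  have h4 : (1 - σ) * m ^ 2 * (|B| * s) ≤ m * (1 + (2 + ℓ) * (κ * (1 + κ))) * T := by
    calc _ ≤ T + m ^ 2 * (2 + ℓ) * (κ * (1 + κ) * T / m) := h3.trans (by gcongr)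
      _ = T + m * (2 + ℓ) * (κ * (1 + κ)) * T := by field_simp
      _ ≤ m * T + m * (2 + ℓ) * (κ * (1 + κ)) * T := by gcongr; nlinarith
      _ = _ := by ring
  have h6 : |B| * s ≤ (1 + (2 + ℓ) * (κ * (1 + κ))) / (1 - σ) * T / m := by
    rw [div_mul_eq_mul_div, div_div, le_div_iff₀ (by positivity)]
    have h5 : m * (|B| * s * ((1 - σ) * m)) ≤ m * ((1 + (2 + ℓ) * (κ * (1 + κ))) * T) := by
      linarith
    exact le_of_mul_le_mul_left h5 hm0
  calc |B| * c ≤ |B| * (κ * s) := by gcongr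
    _ = κ * (|B| * s) := by ring
    _ ≤ _ := by gcongr

/-- For `m ≥ 2α` the constant `2` works. The finitely many remaining ratios are finite since `α` is
not a positive integer, and adding them all to `2` covers each of them. -/
theorem exists_sq_le_mul_abs_sub {α : ℝ} (hα₀ : 0 ≤ α) (hα : ∀ m : ℕ, 1 ≤ m → α ≠ m) :
    ∃ ρ : ℝ, 0 < ρ ∧ ∀ m : ℕ, 1 ≤ m → 0 < |(m : ℝ) ^ 2 - α ^ 2| ∧
      (m : ℝ) ^ 2 ≤ ρ * |(m : ℝ) ^ 2 - α ^ 2| := by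
  set N := ⌈2 * α⌉₊ with hN
  have hS : 0 ≤ ∑ k ∈ Finset.range (N + 1), (k : ℝ) ^ 2 / |(k : ℝ) ^ 2 - α ^ 2| :=
    Finset.sum_nonneg fun k _ => by positivity
  refine ⟨2 + ∑ k ∈ Finset.range (N + 1), (k : ℝ) ^ 2 / |(k : ℝ) ^ 2 - α ^ 2|, by positivity,
    fun m hm => ?_⟩
  have hm0 : (0 : ℝ) < m := by exact_mod_cast hm
  have hpos : 0 < |(m : ℝ) ^ 2 - α ^ 2| := by
    rw [abs_pos, sub_ne_zero]
    intro h
    exact hα m hm ((sq_eq_sq₀ hα₀ hm0.le).1 h.symm)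
  refine ⟨hpos, ?_⟩
  by_cases h : m ≤ N
  · have := Finset.single_le_sum (f := fun k : ℕ => (k : ℝ) ^ 2 / |(k : ℝ) ^ 2 - α ^ 2|)
      (fun k _ => by positivity) (Finset.mem_range.2 (Nat.lt_succ_of_le h))
    rw [← div_le_iff₀ hpos]
    refine this.trans ?_
    linarith
  · have h1 : 2 * α ≤ m := (Nat.le_ceil _).trans (by exact_mod_cast (not_le.1 h).le)
    have h2 : (m : ℝ) ^ 2 ≤ 2 * |(m : ℝ) ^ 2 - α ^ 2| := by
      refine le_trans ?_ (mul_le_mul_of_nonneg_left (le_abs_self _) zero_le_two)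
      nlinarith
    refine h2.trans ?_
    gcongr
    linarith

/-- The coefficients of the `m`-th mode are `O(|γ_m| m⁻³)` after multiplication with
`cosh(mℓ)`. -/
theorem exists_modeSize_le (hℓ : 0 < ℓ) (hσ₀ : 0 < σ) (hσ₁ : σ < 1) {α : ℝ} (hα₀ : 0 ≤ α)
    (hα : ∀ m : ℕ, 1 ≤ m → α ≠ m) :
    ∃ M : ℝ, 0 ≤ M ∧ ∀ m : ℕ, 1 ≤ m → ∀ γ A B C D : ℝ, SystemAD ℓ σ α γ m A D →
      SystemBC ℓ σ α γ m B C →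
      modeSize ℓ α m (γ / ((m : ℝ) ^ 2 - α ^ 2) ^ 2) A B C D ≤ M * (|γ| / (m : ℝ) ^ 3) := by
  obtain ⟨ρ, hρ0, hρ⟩ := exists_sq_le_mul_abs_sub hα₀ hα
  set κ := Real.cosh ℓ / Real.sinh ℓ with hκ
  have hκ0 : 0 ≤ κ := div_nonneg (Real.cosh_pos _).le (Real.sinh_pos_iff.2 hℓ).le
  -- Chosen so that `|γ| / m² * Q` bounds all four right-hand sides; `1 + α` absorbs the factor `α`
  -- of the second rows.
  set Q := (2 + α ^ 2) * ρ ^ 2 * ((1 + α) * Real.cosh (α * ℓ)) with hQ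
  have hcα := Real.cosh_pos (α * ℓ)
  have hQ0 : 0 ≤ Q := by positivity
  have hσ' : 0 < 1 - σ := by linarith
  refine ⟨ρ ^ 2 * Real.exp (α * ℓ) + ((1 + (2 + ℓ) * (1 + κ)) / (1 - σ) +
    κ * ((1 + (2 + ℓ) * (κ * (1 + κ))) / (1 - σ)) + κ * (1 + κ) + (1 + κ)) * Q, by positivity,
    fun m hm γ A B C D hAD hBC => ?_⟩
  have hm' : (1 : ℝ) ≤ m := by exact_mod_cast hm
  have hm0 : (0 : ℝ) < m := by linarith
  obtain ⟨hpos, hle⟩ := hρ m hm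
  have hinv : |γ / ((m : ℝ) ^ 2 - α ^ 2) ^ 2| ≤ |γ| * (ρ ^ 2 / (m : ℝ) ^ 4) := by
    rw [abs_div, abs_pow, div_eq_mul_inv]
    gcongr
    rw [inv_eq_one_div, div_le_div_iff₀ (by positivity) (by positivity), one_mul]
    calc (m : ℝ) ^ 4 = ((m : ℝ) ^ 2) ^ 2 := by ring
      _ ≤ (ρ * |(m : ℝ) ^ 2 - α ^ 2|) ^ 2 := by gcongr
      _ = _ := by ring
  have hfrac : ∀ τ : ℝ, 0 ≤ τ → τ ≤ 2 →
      |γ * ((τ * (m : ℝ) ^ 2 - α ^ 2) / ((m : ℝ) ^ 2 - α ^ 2) ^ 2)| ≤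
        |γ| / (m : ℝ) ^ 2 * ((2 + α ^ 2) * ρ ^ 2) := by
    intro τ h0 h2
    have k1 : |τ * (m : ℝ) ^ 2 - α ^ 2| ≤ (2 + α ^ 2) * (m : ℝ) ^ 2 := by
      have : α ^ 2 * 1 ≤ α ^ 2 * (m : ℝ) ^ 2 := by gcongr; nlinarith
      have : τ * (m : ℝ) ^ 2 ≤ 2 * (m : ℝ) ^ 2 := by gcongr
      have : 0 ≤ τ * (m : ℝ) ^ 2 := by positivity
      rw [abs_le]; constructor <;> nlinarith
    calc _ = |τ * (m : ℝ) ^ 2 - α ^ 2| * |γ / ((m : ℝ) ^ 2 - α ^ 2) ^ 2| := by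
          rw [← abs_mul]; congr 1; ring
      _ ≤ ((2 + α ^ 2) * (m : ℝ) ^ 2) * (|γ| * (ρ ^ 2 / (m : ℝ) ^ 4)) := by gcongr
      _ = _ := by field_simp
  have hsα : |Real.sinh (α * ℓ)| ≤ Real.cosh (α * ℓ) := by
    rw [Real.abs_sinh, ← Real.cosh_abs]
    exact (Real.sinh_lt_cosh _).le
  have hcc : |Real.cosh (α * ℓ)| ≤ Real.cosh (α * ℓ) := (abs_of_pos hcα).le
  set T := |γ| / (m : ℝ) ^ 2 * Q with hT
  have hr1 : ∀ τ F : ℝ, 0 ≤ τ → τ ≤ 2 → |F| ≤ Real.cosh (α * ℓ) →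
      |γ * ((τ * (m : ℝ) ^ 2 - α ^ 2) / ((m : ℝ) ^ 2 - α ^ 2) ^ 2) * F| ≤ T := by
    intro τ F h0 h2 hF
    refine (abs_mul_le_of_le (hfrac τ h0 h2) hF).trans ?_
    rw [hT, hQ]
    have : 0 ≤ |γ| / (m : ℝ) ^ 2 * ((2 + α ^ 2) * ρ ^ 2) * (α * Real.cosh (α * ℓ)) := by
      positivity
    nlinarith
  have hr2 : ∀ τ F : ℝ, 0 ≤ τ → τ ≤ 2 → |F| ≤ Real.cosh (α * ℓ) →
      |α * γ * ((τ * (m : ℝ) ^ 2 - α ^ 2) / ((m : ℝ) ^ 2 - α ^ 2) ^ 2) * F| ≤ T := by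
    intro τ F h0 h2 hF
    have := abs_mul_le_of_le (le_of_eq (abs_of_nonneg hα₀)) (abs_mul_le_of_le (hfrac τ h0 h2) hF)
    rw [mul_assoc α, mul_assoc α]
    refine this.trans ?_
    rw [hT, hQ]
    have : 0 ≤ |γ| / (m : ℝ) ^ 2 * ((2 + α ^ 2) * ρ ^ 2) * (Real.cosh (α * ℓ)) := by
      positivity
    nlinarith
  have ht : 0 < m * ℓ := by positivity
  have hs := Real.sinh_pos_iff.2 ht
  have hc := Real.cosh_pos (m * ℓ)
  have hcs := Real.cosh_sq (m * ℓ)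
  have hk := cosh_le_mul_sinh hℓ hm'
  obtain ⟨bD, bA⟩ := abs_le_of_systemAD hℓ hσ₀ hσ₁ hm' hs hc hcs
    (self_le_sinh_mul_cosh ht.le) hk (Real.sinh_lt_cosh _).le hκ0 hAD.1 hAD.2
    (hr1 _ _ hσ₀.le (by linarith) hcc) (hr2 _ _ (by linarith) (by linarith) hsα)
  obtain ⟨bC, bB⟩ := abs_le_of_systemBC hℓ hσ₀ hσ₁ hm' hs hc hcs
    hk (Real.sinh_lt_cosh _).le hκ0 hBC.1 hBC.2
    (hr1 _ _ hσ₀.le (by linarith) hsα) (hr2 _ _ (by linarith) (by linarith) hcc)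
  have bE : |γ / ((m : ℝ) ^ 2 - α ^ 2) ^ 2| * Real.exp (α * ℓ) ≤
      ρ ^ 2 * Real.exp (α * ℓ) * (|γ| / (m : ℝ) ^ 3) := by
    calc _ ≤ |γ| * (ρ ^ 2 / (m : ℝ) ^ 4) * Real.exp (α * ℓ) := by gcongr
      _ ≤ |γ| * (ρ ^ 2 / (m : ℝ) ^ 3) * Real.exp (α * ℓ) := by
          gcongr
          · norm_num
      _ = _ := by ring
  have hTm : T / m = Q * (|γ| / (m : ℝ) ^ 3) := by rw [hT]; field_simp
  rw [mul_div_assoc, hTm] at bA bB bC bD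
  unfold modeSize
  rw [add_mul, add_mul, add_mul]
  refine (add_le_add bE (add_le_add (add_le_add (add_le_add bA bB) bC) bD)).trans_eq ?_
  ring

end Systems

/-! ### The plate form and uniqueness -/

section Form

variable {ℓ σ : ℝ} {u v w : ℝ × ℝ → ℝ}

theorem MemH2.integrable_mul_weakPartial₂ (hu : MemH2 (plate ℓ) u) (hv : MemH2 (plate ℓ) v)
    (i j k l : Fin 2) :
    IntegrableOn (fun p => weakPartial₂ ℓ i j u p * weakPartial₂ ℓ k l v p) (plate ℓ) :=
  (hu.memLp_weakPartial₂ i j).integrable_mul (hv.memLp_weakPartial₂ k l)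

/-- The plate form expanded into integrals of products of second derivatives. -/
theorem plateForm_eq (hu : MemH2 (plate ℓ) u) (hv : MemH2 (plate ℓ) v) :
    plateForm ℓ σ u v =
      (∫ p in plate ℓ, weakPartial₂ ℓ 0 0 v p * weakPartial₂ ℓ 0 0 u p) +
      σ * (∫ p in plate ℓ, weakPartial₂ ℓ 0 0 v p * weakPartial₂ ℓ 1 1 u p) +
      (∫ p in plate ℓ, weakPartial₂ ℓ 1 1 v p * weakPartial₂ ℓ 1 1 u p) +
      σ * (∫ p in plate ℓ, weakPartial₂ ℓ 1 1 v p * weakPartial₂ ℓ 0 0 u p) +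
      2 * (1 - σ) * (∫ p in plate ℓ, weakPartial₂ ℓ 0 1 v p * weakPartial₂ ℓ 0 1 u p) := by
  have i := fun a b c d => hv.integrable_mul_weakPartial₂ hu a b c d
  rw [← integral_const_mul, ← integral_const_mul, ← integral_const_mul]
  have h1 := integral_add (i 0 0 0 0) ((i 0 0 1 1).const_mul σ)
  have h2 := integral_add ((i 0 0 0 0).add ((i 0 0 1 1).const_mul σ)) (i 1 1 1 1)
  have h3 := integral_add (((i 0 0 0 0).add ((i 0 0 1 1).const_mul σ)).add (i 1 1 1 1))
    ((i 1 1 0 0).const_mul σ)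
  have h4 := integral_add ((((i 0 0 0 0).add ((i 0 0 1 1).const_mul σ)).add (i 1 1 1 1)).add
    ((i 1 1 0 0).const_mul σ)) ((i 0 1 0 1).const_mul (2 * (1 - σ)))
  simp only [Pi.add_apply] at h1 h2 h3 h4
  rw [← h1, ← h2, ← h3, ← h4, plateForm]
  congr 1 with p
  simp only [weakLaplacian]
  ring

theorem plateForm_sub_left (hu : MemH2 (plate ℓ) u) (hw : MemH2 (plate ℓ) w)
    (hv : MemH2 (plate ℓ) v) :
    plateForm ℓ σ (w - u) v = plateForm ℓ σ w v - plateForm ℓ σ u v := by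
  obtain ⟨hd, e⟩ := hw.sub (isOpen_plate ℓ) hu
  have key : ∀ i j k l, ∫ p in plate ℓ, weakPartial₂ ℓ i j v p * weakPartial₂ ℓ k l (w - u) p =
      (∫ p in plate ℓ, weakPartial₂ ℓ i j v p * weakPartial₂ ℓ k l w p) -
        ∫ p in plate ℓ, weakPartial₂ ℓ i j v p * weakPartial₂ ℓ k l u p := by
    intro i j k l
    rw [← integral_sub (hv.integrable_mul_weakPartial₂ hw i j k l)
      (hv.integrable_mul_weakPartial₂ hu i j k l)]
    refine integral_congr_ae ?_
    filter_upwards [e k l] with p hp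
    rw [weakPartial₂, weakPartial₂, hp, Pi.sub_apply, mul_sub]
    rfl
  rw [plateForm_eq hd hv, plateForm_eq hw hv, plateForm_eq hu hv]
  simp only [key]
  ring

/-- The integrand of the form at `(v, v)` is `σ (Δv)² + (1-σ)(v_xx² + v_yy² + 2 v_xy²)`, hence at
least `(1-σ) v_xx²`. -/
theorem weakPartial_xx_ae_eq_zero (hσ₀ : 0 < σ) (hσ₁ : σ < 1) (hv : MemH2 (plate ℓ) v)
    (h : plateForm ℓ σ v v = 0) : weakPartial₂ ℓ 0 0 v =ᵐ[volume.restrict (plate ℓ)] 0 := by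
  have hint := hv.integrable_mul_weakPartial₂ hv 0 0 0 0
  have hσ' : 0 < 1 - σ := by linarith
  have hle : ∫ p in plate ℓ, (1 - σ) * (weakPartial₂ ℓ 0 0 v p * weakPartial₂ ℓ 0 0 v p) ≤
      plateForm ℓ σ v v := by
    refine integral_mono (hint.const_mul _) ?_ fun p => ?_
    · have i := fun a b c d => hv.integrable_mul_weakPartial₂ hv a b c d
      have := (((i 0 0 0 0).add ((i 0 0 1 1).const_mul (2 * σ))).add (i 1 1 1 1)).add
        ((i 0 1 0 1).const_mul (2 * (1 - σ)))
      refine this.congr (Eventually.of_forall fun p => ?_)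
      simp only [Pi.add_apply, weakLaplacian]
      ring
    · simp only [weakLaplacian]
      nlinarith [mul_nonneg hσ₀.le (sq_nonneg (weakPartial₂ ℓ 0 0 v p + weakPartial₂ ℓ 1 1 v p)),
        mul_nonneg hσ'.le (sq_nonneg (weakPartial₂ ℓ 0 1 v p)),
        mul_nonneg hσ'.le (sq_nonneg (weakPartial₂ ℓ 1 1 v p))]
  rw [h, integral_const_mul] at hle
  have h0 : ∫ p in plate ℓ, weakPartial₂ ℓ 0 0 v p * weakPartial₂ ℓ 0 0 v p = 0 :=
    le_antisymm (nonpos_of_mul_nonpos_right hle hσ')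
      (integral_nonneg fun p => mul_self_nonneg _)
  rw [integral_eq_zero_iff_of_nonneg (fun p => mul_self_nonneg _) hint] at h0
  filter_upwards [h0] with p hp
  exact mul_self_eq_zero.1 hp

theorem restrict_plate (ℓ : ℝ) : (volume.restrict (plate ℓ) : Measure (ℝ × ℝ)) =
    (volume.restrict (Ioo 0 Real.pi)).prod (volume.restrict (Ioo (-ℓ) ℓ)) := by
  rw [Measure.prod_restrict, ← Measure.volume_eq_prod, plate]

/-- By Fubini and the fundamental lemma in `y`, each sine coefficient of `v(·, y)` vanishes for
almost every `y`. There are countably many, so one null set serves for all, and completeness of the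
sines applies on almost every slice. -/
theorem ae_eq_zero_of_tensor_sin (hv : IntegrableOn v (plate ℓ))
    (h : ∀ m : ℕ, 1 ≤ m → ∀ b : ℝ → ℝ, ContDiff ℝ ∞ b →
      ∫ p in plate ℓ, v p * (Real.sin (m * p.1) * b p.2) = 0) :
    v =ᵐ[volume.restrict (plate ℓ)] 0 := by
  have hv' : Integrable v ((volume.restrict (Ioo 0 Real.pi)).prod
      (volume.restrict (Ioo (-ℓ) ℓ))) := by rw [← restrict_plate]; exact hv
  have hS : ∀ m : ℕ, 1 ≤ m → ∀ᵐ y ∂volume.restrict (Ioo (-ℓ) ℓ),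
      ∫ x in Ioo 0 Real.pi, v (x, y) * Real.sin (m * x) = 0 := by
    intro m hm
    have hi := integrableOn_mul_continuous hv (F := fun p => Real.sin (m * p.1)) (by fun_prop)
    rw [IntegrableOn, restrict_plate] at hi
    have key := isOpen_Ioo.ae_eq_zero_of_integral_contDiff_smul_eq_zero (μ := volume)
      (U := Ioo (-ℓ) ℓ) (f := fun y => ∫ x in Ioo 0 Real.pi, v (x, y) * Real.sin (m * x))
      (IntegrableOn.locallyIntegrableOn hi.integral_prod_right) (fun φ hφ hc hs => ?_)
    · rw [ae_restrict_iff' measurableSet_Ioo]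
      exact key
    · rw [← setIntegral_eq_integral_of_forall_compl_eq_zero (s := Ioo (-ℓ) ℓ) (fun p hp => by
        rw [image_eq_zero_of_notMem_tsupport (fun h => hp (hs h)), zero_smul])]
      have hi2 := integrableOn_mul_continuous hv
        (F := fun p => Real.sin (m * p.1) * φ p.2) (by have := hφ.continuous; fun_prop)
      rw [IntegrableOn, restrict_plate] at hi2
      have e := h m hm φ hφ
      rw [restrict_plate, integral_prod_symm _ hi2] at e
      refine Eq.trans ?_ e
      congr 1 with y
      rw [smul_eq_mul, ← integral_const_mul]
      congr 1 with x
      ring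
  have hall : ∀ᵐ y ∂volume.restrict (Ioo (-ℓ) ℓ),
      ∀ m : ℕ, 1 ≤ m → ∫ x in Ioo 0 Real.pi, v (x, y) * Real.sin (m * x) = 0 := by
    rw [ae_all_iff]
    intro m
    by_cases hm : 1 ≤ m
    · filter_upwards [hS m hm] with y hy _ using hy
    · exact Eventually.of_forall fun y h => absurd h hm
  have hzero : ∫ p in plate ℓ, |v p| = 0 := by
    rw [restrict_plate, integral_prod_symm _ hv'.abs]
    refine integral_eq_zero_of_ae ?_
    filter_upwards [hall, hv'.prod_left_ae] with y hy hyi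
    have := ae_eq_zero_of_integral_mul_sin_eq_zero hyi hy
    refine integral_eq_zero_of_ae ?_
    filter_upwards [this] with x hx
    simpa using hx
  rw [integral_eq_zero_iff_of_nonneg (fun p => abs_nonneg _) hv.abs] at hzero
  filter_upwards [hzero] with p hp
  exact abs_eq_zero.1 hp

theorem closure_plate (hℓ : 0 < ℓ) : closure (plate ℓ) = closedPlate ℓ := by
  rw [plate, closure_prod_eq, closure_Ioo Real.pi_pos.ne, closure_Ioo (by linarith), closedPlate]

/-- Testing `v_xx = 0` against `sin(mx) b(y)` gives `m² ∫ v sin(mx) b(y) = 0`; this replaces a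
Poincaré inequality. Continuity carries `v = 0` to the closed plate. -/
theorem MemH2Star.eqOn_zero (hℓ : 0 < ℓ) (hσ₀ : 0 < σ) (hσ₁ : σ < 1) (hv : MemH2Star ℓ v)
    (h : plateForm ℓ σ v v = 0) : EqOn v 0 (closedPlate ℓ) := by
  have hxx := weakPartial_xx_ae_eq_zero hσ₀ hσ₁ hv.memH2 h
  have hae : v =ᵐ[volume.restrict (plate ℓ)] 0 := by
    refine ae_eq_zero_of_tensor_sin hv.memH2.integrableOn fun m hm b hb => ?_
    have e := hv.integral_dxx_mul_sin m hℓ.le hb (Real.sin_nat_mul_pi m)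
    have e0 : ∫ p in plate ℓ, weakPartial₂ ℓ 0 0 v p * (Real.sin (m * p.1) * b p.2) = 0 := by
      refine integral_eq_zero_of_ae ?_
      filter_upwards [hxx] with p hp
      rw [hp]; simp
    rw [e0] at e
    have hm0 : (m : ℝ) ≠ 0 := by positivity
    exact (mul_eq_zero.1 e.symm).resolve_left (by simpa using hm0)
  have hsub := plate_subset_closedPlate ℓ
  have := Measure.eqOn_open_of_ae_eq hae (isOpen_plate ℓ) (hv.continuousOn.mono hsub)
    continuousOn_const
  exact this.of_subset_closure hv.continuousOn continuousOn_const hsub (closure_plate hℓ).ge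

theorem IsWeakSolution.eqOn {f : ℝ × ℝ → ℝ} (hℓ : 0 < ℓ) (hσ₀ : 0 < σ) (hσ₁ : σ < 1)
    (hw : IsWeakSolution ℓ σ f w) (hu : IsWeakSolution ℓ σ f u) :
    EqOn w u (closedPlate ℓ) := by
  have hd := hw.1.sub hu.1
  have h := hd.eqOn_zero hℓ hσ₀ hσ₁ (by
    rw [plateForm_sub_left hu.1.memH2 hw.1.memH2 hd.memH2, hw.2 _ hd, hu.2 _ hd, sub_self])
  exact fun p hp => sub_eq_zero.1 (h hp)

end Form

/-! ### Series of smooth functions -/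

theorem hasWeakPartial_of_contDiff {Ω : Set (ℝ × ℝ)} {F : ℝ × ℝ → ℝ}
    (hF : ContDiff ℝ ∞ F) (i : Fin 2) :
    HasWeakPartial Ω i F fun p => fderiv ℝ F p (dir i) := by
  have hc := continuous_fderiv_apply_dir hF i
  refine ⟨hF.continuous.locallyIntegrable.locallyIntegrableOn Ω,
    hc.locallyIntegrable.locallyIntegrableOn Ω, fun φ hφ hφc hs => ?_⟩
  have hs' := (tsupport_fderiv_apply_dir_subset φ i).trans hs
  have hφ' := continuous_fderiv_apply_dir hφ i
  rw [setIntegral_eq_integral_of_forall_compl_eq_zero (fun p hp => by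
      rw [image_eq_zero_of_notMem_tsupport (f := fun p => fderiv ℝ φ p (dir i))
        (fun h => hp (hs' h)), mul_zero]),
    setIntegral_eq_integral_of_forall_compl_eq_zero (fun p hp => by
      rw [image_eq_zero_of_notMem_tsupport (fun h => hp (hs h)), mul_zero])]
  exact integral_mul_fderiv_eq_neg_fderiv_mul_of_integrable
    ((hc.mul hφ.continuous).integrable_of_hasCompactSupport hφc.mul_left)
    ((hF.continuous.mul hφ').integrable_of_hasCompactSupport
      (hasCompactSupport_fderiv_apply_dir hφc i).mul_left)
    ((hF.continuous.mul hφ.continuous).integrable_of_hasCompactSupport hφc.mul_left)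
    (fun x _ => hF.differentiable (by simp) x) (fun x _ => hφ.differentiable (by simp) x)

theorem hasWeakPartial_tensor_zero {Ω : Set (ℝ × ℝ)} {a a' b : ℝ → ℝ} (ha : ContDiff ℝ ∞ a)
    (ha' : ∀ x, HasDerivAt a (a' x) x) (hb : ContDiff ℝ ∞ b) :
    HasWeakPartial Ω 0 (fun p => a p.1 * b p.2) fun p => a' p.1 * b p.2 := by
  have h := hasWeakPartial_of_contDiff (Ω := Ω) (contDiff_tensor ha hb) 0
  simp_rw [fderiv_tensor_zero (ha.differentiable (by simp)) (hb.differentiable (by simp)),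
    fun x => (ha' x).deriv] at h
  exact h

theorem hasWeakPartial_tensor_one {Ω : Set (ℝ × ℝ)} {a b b' : ℝ → ℝ} (ha : ContDiff ℝ ∞ a)
    (hb : ContDiff ℝ ∞ b) (hb' : ∀ x, HasDerivAt b (b' x) x) :
    HasWeakPartial Ω 1 (fun p => a p.1 * b p.2) fun p => a p.1 * b' p.2 := by
  have h := hasWeakPartial_of_contDiff (Ω := Ω) (contDiff_tensor ha hb) 1
  simp_rw [fderiv_tensor_one (ha.differentiable (by simp)) (hb.differentiable (by simp)),
    fun x => (hb' x).deriv] at h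
  exact h

/-- A series of continuous functions with a summable majorant on the closed plate. -/
structure MajorizedSeries (ℓ : ℝ) (f : ℕ → ℝ × ℝ → ℝ) (c : ℕ → ℝ) : Prop where
  continuous : ∀ n, Continuous (f n)
  summable : Summable c
  bound : ∀ n, ∀ p ∈ closedPlate ℓ, |f n p| ≤ c n

section Series

variable {ℓ : ℝ} {f f' : ℕ → ℝ × ℝ → ℝ} {c c' : ℕ → ℝ}

theorem MajorizedSeries.continuousOn_tsum (h : MajorizedSeries ℓ f c) :
    ContinuousOn (fun p => ∑' n, f n p) (closedPlate ℓ) :=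
  _root_.continuousOn_tsum (fun n => (h.continuous n).continuousOn) h.summable h.bound

theorem MajorizedSeries.memLp_tsum (h : MajorizedSeries ℓ f c) :
    MemLp (fun p => ∑' n, f n p) 2 (volume.restrict (plate ℓ)) := by
  obtain ⟨K, hK⟩ := (isCompact_closedPlate ℓ).exists_bound_of_continuousOn h.continuousOn_tsum
  refine MemLp.of_bound ((h.continuousOn_tsum.mono
    (plate_subset_closedPlate ℓ)).aestronglyMeasurable (measurableSet_plate ℓ)) K ?_
  filter_upwards [ae_restrict_mem (measurableSet_plate ℓ)] with p hp
  exact hK p (plate_subset_closedPlate ℓ hp)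

theorem MajorizedSeries.hasSum_integral (h : MajorizedSeries ℓ f c) {w : ℝ × ℝ → ℝ}
    (hw : IntegrableOn w (plate ℓ)) :
    HasSum (fun n => ∫ p in plate ℓ, w p * f n p) (∫ p in plate ℓ, w p * ∑' n, f n p) := by
  have hi : ∀ n, IntegrableOn (fun p => w p * f n p) (plate ℓ) := fun n =>
    integrableOn_mul_continuous hw (h.continuous n)
  have hs : Summable fun n => ∫ p in plate ℓ, ‖w p * f n p‖ := by
    refine Summable.of_nonneg_of_le (fun n => integral_nonneg fun p => norm_nonneg _) (fun n => ?_)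
      (h.summable.mul_left (∫ p in plate ℓ, |w p|))
    rw [← integral_mul_const]
    refine integral_mono_ae (hi n).norm (hw.abs.mul_const _) ?_
    filter_upwards [ae_restrict_mem (measurableSet_plate ℓ)] with p hp
    rw [norm_mul]
    exact mul_le_mul_of_nonneg_left (h.bound n p (plate_subset_closedPlate ℓ hp)) (abs_nonneg _)
  have := hasSum_integral_of_summable_integral_norm hi hs
  simp_rw [tsum_mul_left] at this
  exact this

/-- The defining identity is linear and is integrated termwise on both sides, so majorants for the
terms and for their derivatives suffice. -/
theorem MajorizedSeries.hasWeakPartial_tsum (h : MajorizedSeries ℓ f c)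
    (h' : MajorizedSeries ℓ f' c') {i : Fin 2}
    (hd : ∀ n, HasWeakPartial (plate ℓ) i (f n) (f' n)) :
    HasWeakPartial (plate ℓ) i (fun p => ∑' n, f n p) (fun p => ∑' n, f' n p) := by
  refine ⟨IntegrableOn.locallyIntegrableOn (h.memLp_tsum.integrable (by norm_num)),
    IntegrableOn.locallyIntegrableOn (h'.memLp_tsum.integrable (by norm_num)),
    fun φ hφ hc hs => ?_⟩
  have hint : ∀ {ψ : ℝ × ℝ → ℝ}, Continuous ψ → HasCompactSupport ψ →
      IntegrableOn ψ (plate ℓ) := fun hψ hψc =>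
    (hψ.integrable_of_hasCompactSupport hψc).integrableOn
  have s1 := h.hasSum_integral (hint (continuous_fderiv_apply_dir hφ i)
    (hasCompactSupport_fderiv_apply_dir hc i))
  have s2 := (h'.hasSum_integral (hint hφ.continuous hc)).neg
  have e : ∀ n, ∫ p in plate ℓ, fderiv ℝ φ p (dir i) * f n p =
      -∫ p in plate ℓ, φ p * f' n p := fun n => by
    have := (hd n).2.2 φ hφ hc hs
    simpa only [mul_comm] using this
  simp_rw [e] at s1
  have := s1.unique s2
  simpa only [mul_comm] using this

end Series

/-! ### The series solution -/

section Solution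

variable {ℓ σ α : ℝ}

/-- The derivatives of the `m`-th mode: bounds on `[-ℓ, ℓ]`, natural boundary conditions, and the
ordinary differential equation. -/
theorem exists_mode_derivs (hα₀ : 0 ≤ α) {m : ℕ} (hm : 1 ≤ m) (hαm : α ≠ m)
    {γ A B C D : ℝ} (hAD : SystemAD ℓ σ α γ m A D) (hBC : SystemBC ℓ σ α γ m B C) :
    ∃ Y : ℕ → ℝ → ℝ, Y 0 = modeCoeff α γ m A B C D ∧ (∀ k, ContDiff ℝ ∞ (Y k)) ∧
      (∀ k y, HasDerivAt (Y k) (Y (k + 1) y) y) ∧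
      (∀ y, y = -ℓ ∨ y = ℓ → Y 2 y - σ * (m : ℝ) ^ 2 * Y 0 y = 0 ∧
        Y 3 y - (2 - σ) * (m : ℝ) ^ 2 * Y 1 y = 0) ∧
      (∀ y, Y 4 y - 2 * (m : ℝ) ^ 2 * Y 2 y + (m : ℝ) ^ 4 * Y 0 y = γ * Real.exp (α * y)) ∧
      ∀ k y, |y| ≤ ℓ → |Y k y| ≤ ((2 + α) * m) ^ k *
        ((1 + ℓ) * modeSize ℓ α m (γ / ((m : ℝ) ^ 2 - α ^ 2) ^ 2) A B C D) := by
  have hm' : (1 : ℝ) ≤ m := by exact_mod_cast hm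
  have hm0 : (0 : ℝ) < m := by linarith
  set E := γ / ((m : ℝ) ^ 2 - α ^ 2) ^ 2 with hE
  have hd : (m : ℝ) ^ 2 - α ^ 2 ≠ 0 := by
    rw [sub_ne_zero]
    intro h
    exact hαm ((sq_eq_sq₀ hα₀ hm0.le).1 h.symm)
  have hEγ : E * ((m : ℝ) ^ 2 - α ^ 2) ^ 2 = γ := div_mul_cancel₀ _ (pow_ne_zero 2 hd)
  -- The action of `d/dy` on the coefficients `(E, A, B, C, D)`, as in `hasDerivAt_modeFn`.
  let step : ℝ × ℝ × ℝ × ℝ × ℝ → ℝ × ℝ × ℝ × ℝ × ℝ := fun q =>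
    (α * q.1, m * q.2.2.1 + q.2.2.2.1, m * q.2.1 + q.2.2.2.2, m * q.2.2.2.2, m * q.2.2.2.1)
  let q : ℕ → ℝ × ℝ × ℝ × ℝ × ℝ := fun k => step^[k] (E, A, B, C, D)
  have hq : ∀ k, q (k + 1) = step (q k) := fun k => Function.iterate_succ_apply' _ _ _
  refine ⟨fun k => modeFn α m (q k).1 (q k).2.1 (q k).2.2.1 (q k).2.2.2.1 (q k).2.2.2.2,
    ?_, fun k => contDiff_modeFn _ _ _ _ _ _ _, fun k y => ?_, ?_, ?_, fun k y hy => ?_⟩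
  · funext y
    simp only [q, Function.iterate_zero, id_eq, modeFn, modeCoeff, hE]
    ring
  · simp only [hq]
    exact hasDerivAt_modeFn _ _ _ _ _ _ _ _
  · obtain ⟨h1, h2⟩ := hAD
    obtain ⟨h3, h4⟩ := hBC
    have r : ∀ τ : ℝ, γ * ((τ * (m : ℝ) ^ 2 - α ^ 2) / ((m : ℝ) ^ 2 - α ^ 2) ^ 2) =
        E * (τ * (m : ℝ) ^ 2 - α ^ 2) := fun τ => by rw [hE]; ring
    rw [mul_assoc α, r] at h2 h4
    rw [r] at h1 h3
    -- Splitting `e^{±αℓ}` into `cosh ± sinh` separates parities: each boundary condition at `ℓ` is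
    -- a sum of one row from each system, and at `-ℓ` a difference.
    have ep := Real.cosh_add_sinh (α * ℓ)
    have em := Real.cosh_sub_sinh (α * ℓ)
    rintro y (rfl | rfl)
    · simp only [q, Function.iterate_succ, Function.iterate_zero, Function.comp, id_eq, modeFn,
        step, mul_neg, Real.cosh_neg, Real.sinh_neg, ← em]
      constructor
      · linear_combination h1 - h3
      · linear_combination h4 - h2
    · simp only [q, Function.iterate_succ, Function.iterate_zero, Function.comp, id_eq, modeFn,
        step, ← ep]
      constructor
      · linear_combination h1 + h3
      · linear_combination h2 + h4
  · intro y
    simp only [q, Function.iterate_succ, Function.iterate_zero, Function.comp, id_eq, modeFn, step]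
    -- The hyperbolic terms are annihilated by `(d²/dy² - m²)²`; only `E (m² - α²)² e^{αy}`
    -- survives.
    linear_combination Real.exp (α * y) * hEγ
  · refine (abs_modeFn_le hα₀ hy _ _ _ _ _).trans ?_
    have hℓ : 0 ≤ ℓ := (abs_nonneg y).trans hy
    have key : modeSize ℓ α m (q k).1 (q k).2.1 (q k).2.2.1 (q k).2.2.2.1 (q k).2.2.2.2 ≤
        ((2 + α) * m) ^ k * modeSize ℓ α m E A B C D := by
      induction k with
      | zero => simp [q]
      | succ k ih =>
        rw [hq]
        refine (modeSize_deriv_le hα₀ hm' ℓ _ _ _ _ _).trans ?_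
        rw [pow_succ']
        calc _ ≤ (2 + α) * m * (((2 + α) * m) ^ k * modeSize ℓ α m E A B C D) := by gcongr
          _ = _ := by ring
    calc _ ≤ (1 + ℓ) * (((2 + α) * m) ^ k * modeSize ℓ α m E A B C D) := by gcongr
      _ = _ := by ring

/-- From `2 |γ_m| / m ≤ γ_m² + 1 / m²` and Bessel. This sequence majorizes the second derivatives of
the series. -/
theorem summable_abs_sineCoeff_div {g : ℝ → ℝ}
    (hg : MemLp g 2 (volume.restrict (Ioo 0 Real.pi))) :
    Summable fun n : ℕ => |sineCoeff g (n + 1)| / ((n + 1 : ℕ) : ℝ) := by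
  have h1 := summable_sineCoeff_sq hg
  have h2 : Summable fun n : ℕ => 1 / ((n + 1 : ℕ) : ℝ) ^ 2 :=
    (summable_nat_add_iff 1).2 (Real.summable_one_div_nat_pow.2 (by norm_num : 1 < 2))
  refine Summable.of_nonneg_of_le (fun n => by positivity) (fun n => ?_)
    ((h1.add h2).mul_left (1 / 2))
  have := two_mul_le_add_sq |sineCoeff g (n + 1)| (1 / ((n + 1 : ℕ) : ℝ))
  rw [sq_abs, div_pow, one_pow] at this
  rw [div_eq_mul_one_div]
  linarith

/-- Parseval's identity on the plate: the load pairs with `v` mode by mode. -/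
theorem hasSum_load_pairing {g : ℝ → ℝ}
    (hg : MemLp g 2 (volume.restrict (Ioo 0 Real.pi))) {v : ℝ × ℝ → ℝ}
    (hc : ContinuousOn v (closedPlate ℓ)) :
    HasSum (fun n : ℕ => ∫ p in plate ℓ, v p * (Real.sin ((n + 1 : ℕ) * p.1) *
        (sineCoeff g (n + 1) * Real.exp (α * p.2))))
      (∫ p in plate ℓ, Real.exp (α * p.2) * g p.1 * v p) := by
  have hcw : ContinuousOn (fun p : ℝ × ℝ => v p * Real.exp (α * p.2)) (closedPlate ℓ) :=
    hc.mul (by fun_prop)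
  obtain ⟨K, hK⟩ := (isCompact_closedPlate ℓ).exists_bound_of_continuousOn hcw
  have hwi : IntegrableOn (fun p : ℝ × ℝ => v p * Real.exp (α * p.2)) (plate ℓ) :=
    (hcw.integrableOn_compact (isCompact_closedPlate ℓ)).mono_set (plate_subset_closedPlate ℓ)
  have hwi' := hwi
  rw [IntegrableOn, restrict_plate] at hwi'
  -- Integrating out `y` reduces the pairing to one-dimensional Parseval for `g` and the bounded
  -- function `V`.
  set V : ℝ → ℝ := fun x => ∫ y in Ioo (-ℓ) ℓ, v (x, y) * Real.exp (α * y) with hV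
  have hVL : MemLp V 2 (volume.restrict (Ioo 0 Real.pi)) := by
    refine MemLp.of_bound hwi'.integral_prod_left.aestronglyMeasurable
      (K * volume.real (Ioo (-ℓ) ℓ)) ?_
    filter_upwards [ae_restrict_mem measurableSet_Ioo] with x hx
    exact norm_setIntegral_le_of_norm_le_const measure_Ioo_lt_top fun y hy =>
      hK (x, y) (plate_subset_closedPlate ℓ ⟨hx, hy⟩)
  have h := hasSum_sineCoeff_mul_integral hg hVL
  have e1 : ∀ n : ℕ, ∫ p in plate ℓ, v p * (Real.sin ((n + 1 : ℕ) * p.1) *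
      (sineCoeff g (n + 1) * Real.exp (α * p.2))) = sineCoeff g (n + 1) *
      ∫ x in Ioo 0 Real.pi, V x * Real.sin ((n + 1 : ℕ) * x) := by
    intro n
    have hi := integrableOn_mul_continuous hwi (F := fun p : ℝ × ℝ => sineCoeff g (n + 1) *
      Real.sin ((n + 1 : ℕ) * p.1)) (by fun_prop)
    rw [IntegrableOn, restrict_plate] at hi
    have e := integral_prod _ hi
    rw [restrict_plate, ← integral_const_mul]
    refine Eq.trans ?_ (e.trans ?_)
    · congr 1 with p
      ring
    · congr 1 with x
      dsimp only
      rw [integral_mul_const, hV]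
      ring
  have e2 : ∫ p in plate ℓ, Real.exp (α * p.2) * g p.1 * v p =
      ∫ x in Ioo 0 Real.pi, g x * V x := by
    have hg1 : Integrable (fun p : ℝ × ℝ => g p.1 * (1 : ℝ))
        ((volume.restrict (Ioo 0 Real.pi)).prod (volume.restrict (Ioo (-ℓ) ℓ))) :=
      (hg.integrable (by norm_num)).mul_prod (integrable_const (1 : ℝ))
    have hi : Integrable (fun p : ℝ × ℝ => g p.1 * 1 * (v p * Real.exp (α * p.2)))
        ((volume.restrict (Ioo 0 Real.pi)).prod (volume.restrict (Ioo (-ℓ) ℓ))) := by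
      refine hg1.mul_bdd (c := K) hwi'.aestronglyMeasurable ?_
      rw [← restrict_plate]
      filter_upwards [ae_restrict_mem (measurableSet_plate ℓ)] with p hp
      exact hK p (plate_subset_closedPlate ℓ hp)
    have e := integral_prod _ hi
    rw [restrict_plate]
    refine Eq.trans ?_ (e.trans ?_)
    · congr 1 with p
      ring
    · congr 1 with x
      dsimp only
      rw [integral_const_mul, mul_one]
  simp_rw [e1, e2]
  exact h

/-- The form and the load are both sums over modes, equal term by term through Green's formula for
one mode. Only derivatives of order at most two are summed, and these share one majorant. -/
theorem series_isWeakSolution (hℓ : 0 < ℓ) (hσ₀ : 0 < σ) (hσ₁ : σ < 1) (hα₀ : 0 ≤ α)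
    (hα : ∀ m : ℕ, 1 ≤ m → α ≠ m) {g : ℝ → ℝ}
    (hg : MemLp g 2 (volume.restrict (Ioo 0 Real.pi))) {A B C D : ℕ → ℝ}
    (hAD : ∀ m : ℕ, 1 ≤ m → SystemAD ℓ σ α (sineCoeff g m) m (A m) (D m))
    (hBC : ∀ m : ℕ, 1 ≤ m → SystemBC ℓ σ α (sineCoeff g m) m (B m) (C m)) :
    (∃ c, MajorizedSeries ℓ
      (fun n p => loadConst ℓ α g * seriesTerm α g A B C D (n + 1) p) c) ∧
    IsWeakSolution ℓ σ (load ℓ α g)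
      fun p => ∑' n : ℕ, loadConst ℓ α g * seriesTerm α g A B C D (n + 1) p := by
  obtain ⟨M, hM0, hM⟩ := exists_modeSize_le hℓ hσ₀ hσ₁ hα₀ hα
  have hex := fun n : ℕ => exists_mode_derivs hα₀ (Nat.le_add_left 1 n)
    (hα (n + 1) (Nat.le_add_left 1 n)) (hAD (n + 1) (Nat.le_add_left 1 n))
    (hBC (n + 1) (Nat.le_add_left 1 n))
  choose Y hY0 hYs hYd hYbc hYode hYb using hex
  set K := loadConst ℓ α g with hK
  set μ : ℕ → ℝ := fun n => ((n + 1 : ℕ) : ℝ) with hμ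
  have hμ1 : ∀ n, 1 ≤ μ n := fun n => by simp [hμ]
  set γ : ℕ → ℝ := fun n => sineCoeff g (n + 1) with hγ
  -- `a j n` is the `j`-th derivative of `K sin((n+1)x)` for `j ≤ 2`; the load constant is kept in
  -- the `x`-factor.
  set a : ℕ → ℕ → ℝ → ℝ := fun j n x => match j with
    | 0 => K * Real.sin (μ n * x)
    | 1 => K * (μ n * Real.cos (μ n * x))
    | _ => K * (-μ n ^ 2 * Real.sin (μ n * x)) with ha
  have has : ∀ j n, ContDiff ℝ ∞ (a j n) := by
    rintro (_ | _ | j) n <;> simp only [ha] <;> fun_prop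
  have had : ∀ n x, HasDerivAt (a 0 n) (a 1 n x) x := fun n x => by
    have := (((hasDerivAt_id x).const_mul (μ n)).sin).const_mul K
    refine this.congr_deriv ?_
    simp only [ha, id]; ring
  have had' : ∀ n x, HasDerivAt (a 1 n) (a 2 n x) x := fun n x => by
    have := ((((hasDerivAt_id x).const_mul (μ n)).cos).const_mul (μ n)).const_mul K
    refine this.congr_deriv ?_
    simp only [ha, id]; ring
  have hab : ∀ j n x, j ≤ 2 → |a j n x| ≤ |K| * μ n ^ j := by
    intro j n x hj
    have hμp : 0 ≤ μ n := zero_le_one.trans (hμ1 n)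
    have h1 := Real.abs_sin_le_one (μ n * x)
    have h2 := Real.abs_cos_le_one (μ n * x)
    interval_cases j
    · simpa [ha] using abs_mul_le_of_le (le_refl |K|) h1
    · simpa [ha, abs_of_nonneg hμp] using
        abs_mul_le_of_le (le_refl |K|) (abs_mul_le_of_le (le_refl |μ n|) h2)
    · have h3 : |-μ n ^ 2| ≤ μ n ^ 2 := by rw [abs_neg, abs_of_nonneg (pow_nonneg hμp 2)]
      have := abs_mul_le_of_le (le_refl |K|) (abs_mul_le_of_le h3 h1)
      rwa [mul_one] at this
  -- The coefficients decay like `|γ n| / μ n ^ 3` and at most two derivatives cost `μ n ^ 2`.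
  set c : ℕ → ℝ := fun n => |K| * ((2 + α) ^ 2 * ((1 + ℓ) * M)) * (|γ n| / μ n) with hc
  have hcs : Summable c := (summable_abs_sineCoeff_div hg).mul_left _
  have hmaj : ∀ j k, j + k ≤ 2 → MajorizedSeries ℓ (fun n p => a j n p.1 * Y n k p.2) c := by
    refine fun j k hjk => ⟨fun n => (contDiff_tensor (has j n) (hYs n k)).continuous, hcs,
      fun n p hp => ?_⟩
    have hy : |p.2| ≤ ℓ := abs_le.2 hp.2
    have hsz := hM (n + 1) (Nat.le_add_left 1 n) _ _ _ _ _ (hAD (n + 1) (Nat.le_add_left 1 n))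
      (hBC (n + 1) (Nat.le_add_left 1 n))
    have hμp : 0 < μ n := zero_lt_one.trans_le (hμ1 n)
    calc |a j n p.1 * Y n k p.2| ≤ (|K| * μ n ^ j) * (((2 + α) * μ n) ^ k *
          ((1 + ℓ) * (M * (|γ n| / μ n ^ 3)))) := by
          refine abs_mul_le_of_le (hab j n _ (by omega)) ((hYb n k _ hy).trans ?_)
          gcongr
      _ = |K| * ((2 + α) ^ k * ((1 + ℓ) * M)) * (|γ n| / μ n ^ 3 * μ n ^ (j + k)) := by
          rw [mul_pow, pow_add]; ring
      _ ≤ |K| * ((2 + α) ^ 2 * ((1 + ℓ) * M)) * (|γ n| / μ n ^ 3 * μ n ^ 2) := by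
          gcongr
          · linarith
          · omega
          · exact hμ1 n
      _ = c n := by rw [hc]; field_simp
  have hterm : (fun n p => K * seriesTerm α g A B C D (n + 1) p) =
      fun n p => a 0 n p.1 * Y n 0 p.2 := by
    funext n p
    simp only [ha, hY0, seriesTerm, hμ]
    ring
  have hsum : (fun p => ∑' n : ℕ, K * seriesTerm α g A B C D (n + 1) p) =
      fun p => ∑' n : ℕ, a 0 n p.1 * Y n 0 p.2 := by
    funext p
    exact tsum_congr fun n => congrFun (congrFun hterm n) p
  rw [hterm, hsum]
  refine ⟨⟨c, hmaj 0 0 (by norm_num)⟩, ?_⟩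
  set u : ℝ × ℝ → ℝ := fun p => ∑' n : ℕ, a 0 n p.1 * Y n 0 p.2 with hu
  have hx : ∀ k, k ≤ 1 → HasWeakPartial (plate ℓ) 0 (fun p => ∑' n : ℕ, a 0 n p.1 * Y n k p.2)
      (fun p => ∑' n : ℕ, a 1 n p.1 * Y n k p.2) := fun k hk =>
    (hmaj 0 k (by omega)).hasWeakPartial_tsum (hmaj 1 k (by omega))
      fun n => hasWeakPartial_tensor_zero (has 0 n) (had n) (hYs n k)
  have hxx : HasWeakPartial (plate ℓ) 0 (fun p => ∑' n : ℕ, a 1 n p.1 * Y n 0 p.2)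
      (fun p => ∑' n : ℕ, a 2 n p.1 * Y n 0 p.2) :=
    (hmaj 1 0 (by omega)).hasWeakPartial_tsum (hmaj 2 0 (by omega))
      fun n => hasWeakPartial_tensor_zero (has 1 n) (had' n) (hYs n 0)
  have hy : ∀ j k, j + (k + 1) ≤ 2 → HasWeakPartial (plate ℓ) 1
      (fun p => ∑' n : ℕ, a j n p.1 * Y n k p.2)
      (fun p => ∑' n : ℕ, a j n p.1 * Y n (k + 1) p.2) := fun j k hjk =>
    (hmaj j k (by omega)).hasWeakPartial_tsum (hmaj j (k + 1) hjk)
      fun n => hasWeakPartial_tensor_one (has j n) (hYs n k) (hYd n k)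
  have hL : ∀ j k, j + k ≤ 2 → MemLp (fun p => ∑' n : ℕ, a j n p.1 * Y n k p.2) 2
      (volume.restrict (plate ℓ)) := fun j k hjk => (hmaj j k hjk).memLp_tsum
  obtain ⟨hH2, he⟩ := memH2_of_hasWeakPartial (isOpen_plate ℓ) (u := u)
    (g := ![fun p => ∑' n : ℕ, a 1 n p.1 * Y n 0 p.2, fun p => ∑' n : ℕ, a 0 n p.1 * Y n 1 p.2])
    (h := ![![fun p => ∑' n : ℕ, a 2 n p.1 * Y n 0 p.2, fun p => ∑' n : ℕ, a 1 n p.1 * Y n 1 p.2],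
      ![fun p => ∑' n : ℕ, a 1 n p.1 * Y n 1 p.2, fun p => ∑' n : ℕ, a 0 n p.1 * Y n 2 p.2]])
    (hL 0 0 (by norm_num))
    (Fin.forall_fin_two.2 ⟨hx 0 (by norm_num), hy 0 0 (by norm_num)⟩)
    (Fin.forall_fin_two.2 ⟨hL 1 0 (by norm_num), hL 0 1 (by norm_num)⟩)
    (Fin.forall_fin_two.2 ⟨Fin.forall_fin_two.2 ⟨hxx, hy 1 0 (by norm_num)⟩,
      Fin.forall_fin_two.2 ⟨hx 1 (by norm_num), hy 0 1 (by norm_num)⟩⟩)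
    (Fin.forall_fin_two.2 ⟨Fin.forall_fin_two.2 ⟨hL 2 0 (by norm_num), hL 1 1 (by norm_num)⟩,
      Fin.forall_fin_two.2 ⟨hL 1 1 (by norm_num), hL 0 2 (by norm_num)⟩⟩)
  have hstar : MemH2Star ℓ u := by
    refine ⟨hH2, (hmaj 0 0 (by norm_num)).continuousOn_tsum, fun y _ => ⟨?_, ?_⟩⟩
    · simp [hu, ha]
    · have : ∀ n, Real.sin (μ n * Real.pi) = 0 := fun n => Real.sin_nat_mul_pi (n + 1)
      simp [hu, ha, this]
  refine ⟨hstar, fun v hv => ?_⟩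
  have hsumI : ∀ j k (w : ℝ × ℝ → ℝ), j + k ≤ 2 → IntegrableOn w (plate ℓ) →
      ∀ U : ℝ × ℝ → ℝ, U =ᵐ[volume.restrict (plate ℓ)]
        (fun p => ∑' n : ℕ, a j n p.1 * Y n k p.2) →
      HasSum (fun n => ∫ p in plate ℓ, w p * (a j n p.1 * Y n k p.2))
        (∫ p in plate ℓ, w p * U p) := by
    intro j k w hjk hw U hU
    have := (hmaj j k hjk).hasSum_integral hw
    have e : ∫ p in plate ℓ, w p * U p =
        ∫ p in plate ℓ, w p * ∑' n : ℕ, a j n p.1 * Y n k p.2 := by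
      refine integral_congr_ae ?_
      filter_upwards [hU] with p hp
      rw [hp]
    rw [e]
    exact this
  have i00 := hv.memH2.integrableOn_weakPartial₂ 0 0
  have i11 := hv.memH2.integrableOn_weakPartial₂ 1 1
  have i01 := hv.memH2.integrableOn_weakPartial₂ 0 1
  -- The five terms are in the order of `plateForm_eq`, so that the sum is the form itself.
  have S := ((((hsumI 2 0 _ (by norm_num) i00 _ (he 0 0)).add
    ((hsumI 0 2 _ (by norm_num) i00 _ (he 1 1)).mul_left σ)).add
    (hsumI 0 2 _ (by norm_num) i11 _ (he 1 1))).add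
    ((hsumI 2 0 _ (by norm_num) i11 _ (he 0 0)).mul_left σ)).add
    ((hsumI 1 1 _ (by norm_num) i01 _ (he 0 1)).mul_left (2 * (1 - σ)))
  have hform := plateForm_eq (σ := σ) hH2 hv.memH2
  simp only [weakPartial₂] at hform S
  rw [← hform] at S
  have hload := (hasSum_load_pairing (α := α) hg hv.continuousOn).mul_left K
  have e2 : ∫ p in plate ℓ, load ℓ α g p * v p =
      K * ∫ p in plate ℓ, Real.exp (α * p.2) * g p.1 * v p := by
    rw [← integral_const_mul]
    congr 1 with p
    rw [load]; ring
  rw [e2]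
  refine S.unique ?_
  refine Eq.mp (congrArg (fun F => HasSum F _) (funext fun n => ?_)) hload
  have hgreen := hv.green_mode (μ n) hℓ.le (Real.sin_nat_mul_pi (n + 1)) σ (hYd n 0) (hYd n 1)
    (hYd n 2) (hYd n 3) (hYs n 0) (hYbc n)
  simp only [hμ, hYode, weakPartial₂] at hgreen
  rw [← hgreen, ← integral_const_mul]
  have j : ∀ (j k : ℕ) {w : ℝ × ℝ → ℝ}, IntegrableOn w (plate ℓ) →
      IntegrableOn (fun p => w p * (a j n p.1 * Y n k p.2)) (plate ℓ) := fun j k w hw =>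
    integrableOn_mul_continuous hw (contDiff_tensor (has j n) (hYs n k)).continuous
  have h1 := integral_add (j 2 0 i00) ((j 0 2 i00).const_mul σ)
  have h2 := integral_add ((j 2 0 i00).add ((j 0 2 i00).const_mul σ)) (j 0 2 i11)
  have h3 := integral_add (((j 2 0 i00).add ((j 0 2 i00).const_mul σ)).add (j 0 2 i11))
    ((j 2 0 i11).const_mul σ)
  have h4 := integral_add ((((j 2 0 i00).add ((j 0 2 i00).const_mul σ)).add (j 0 2 i11)).add
    ((j 2 0 i11).const_mul σ)) ((j 1 1 i01).const_mul (2 * (1 - σ)))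
  simp only [Pi.add_apply, integral_const_mul, weakPartial₂] at h1 h2 h3 h4
  rw [← h1, ← h2, ← h3, ← h4]
  congr 1 with p
  simp only [ha, hμ]
  ring

/-- Needed to cancel the constant: the majorant controls the series with the factor `K_α`, while
summability is claimed for the series without it. -/
theorem loadConst_ne_zero (hℓ : 0 < ℓ) (hα₀ : 0 ≤ α) {g : ℝ → ℝ}
    (hg : MemLp g 2 (volume.restrict (Ioo 0 Real.pi)))
    (hg₀ : ¬ g =ᵐ[volume.restrict (Ioo 0 Real.pi)] 0) : loadConst ℓ α g ≠ 0 := by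
  have hi : ∫ x in (0 : ℝ)..Real.pi, |g x| ≠ 0 := by
    rw [intervalIntegral.integral_of_le Real.pi_pos.le, integral_Ioc_eq_integral_Ioo]
    intro h
    rw [integral_eq_zero_iff_of_nonneg (fun p => abs_nonneg _)
      (hg.integrable (by norm_num)).abs] at h
    refine hg₀ ?_
    filter_upwards [h] with x hx
    exact abs_eq_zero.1 hx
  unfold loadConst
  split_ifs with h
  · exact one_div_ne_zero (mul_ne_zero (by positivity) hi)
  · have hαp : 0 < α := lt_of_le_of_ne hα₀ (Ne.symm h)
    have := Real.sinh_pos_iff.2 (mul_pos hαp hℓ)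
    exact div_ne_zero h (mul_ne_zero (by positivity) hi)

theorem sum_range_succ_eq_sum_Icc (f : ℕ → ℝ) (N : ℕ) :
    ∑ n ∈ Finset.range N, f (n + 1) = ∑ m ∈ Finset.Icc 1 N, f m := by
  induction N with
  | zero => simp
  | succ N ih => rw [Finset.sum_range_succ, ih, Finset.sum_Icc_succ_top (by omega)]

end Solution

end Plate

/-! ### Assembly of the theorem. -/

theorem theorem2p1 (ℓ σ α : ℝ) (hℓ : 0 < ℓ) (hσ₀ : 0 < σ) (hσ₁ : σ < 1)
    (hα₀ : 0 ≤ α) (hα : ∀ m : ℕ, 1 ≤ m → α ≠ m)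
    (g : ℝ → ℝ) (hg : MemLp g 2 (volume.restrict (Ioo 0 Real.pi)))
    (hg₀ : ¬ g =ᵐ[volume.restrict (Ioo 0 Real.pi)] 0) :
    -- the two linear systems are uniquely solvable for every `m ≥ 1`
    (∀ m : ℕ, 1 ≤ m →
      (∃! AD : ℝ × ℝ, Plate.SystemAD ℓ σ α (Plate.sineCoeff g m) m AD.1 AD.2) ∧
      (∃! BC : ℝ × ℝ, Plate.SystemBC ℓ σ α (Plate.sineCoeff g m) m BC.1 BC.2)) ∧
    -- there is exactly one weak solution `u`, and it is the sum of the series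
    ∃ u : ℝ × ℝ → ℝ,
      Plate.IsWeakSolution ℓ σ (Plate.load ℓ α g) u ∧
      (∀ w, Plate.IsWeakSolution ℓ σ (Plate.load ℓ α g) w → EqOn w u (Plate.closedPlate ℓ)) ∧
      ∀ A B C D : ℕ → ℝ,
        (∀ m : ℕ, 1 ≤ m → Plate.SystemAD ℓ σ α (Plate.sineCoeff g m) m (A m) (D m)) →
        (∀ m : ℕ, 1 ≤ m → Plate.SystemBC ℓ σ α (Plate.sineCoeff g m) m (B m) (C m)) →
        (∀ p ∈ Plate.closedPlate ℓ,
          Summable (fun n : ℕ => Plate.seriesTerm α g A B C D (n + 1) p) ∧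
          u p = Plate.loadConst ℓ α g *
            ∑' n : ℕ, Plate.seriesTerm α g A B C D (n + 1) p) ∧
        TendstoUniformlyOn
          (fun (N : ℕ) (p : ℝ × ℝ) => Plate.loadConst ℓ α g *
            ∑ m ∈ Finset.Icc 1 N, Plate.seriesTerm α g A B C D m p)
          u atTop (Plate.closedPlate ℓ) := by
  have hsysAD := fun m (hm : 1 ≤ m) =>
    Plate.existsUnique_systemAD hℓ hσ₀ hσ₁ α (Plate.sineCoeff g m) hm
  have hsysBC := fun m (hm : 1 ≤ m) =>
    Plate.existsUnique_systemBC hℓ hσ₀ hσ₁ α (Plate.sineCoeff g m) hm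
  refine ⟨fun m hm => ⟨hsysAD m hm, hsysBC m hm⟩, ?_⟩
  have exAD : ∀ m : ℕ, ∃ AD : ℝ × ℝ,
      1 ≤ m → Plate.SystemAD ℓ σ α (Plate.sineCoeff g m) m AD.1 AD.2 := fun m => by
    by_cases hm : 1 ≤ m
    · exact (hsysAD m hm).exists.imp fun _ h _ => h
    · exact ⟨0, fun h => absurd h hm⟩
  have exBC : ∀ m : ℕ, ∃ BC : ℝ × ℝ,
      1 ≤ m → Plate.SystemBC ℓ σ α (Plate.sineCoeff g m) m BC.1 BC.2 := fun m => by
    by_cases hm : 1 ≤ m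
    · exact (hsysBC m hm).exists.imp fun _ h _ => h
    · exact ⟨0, fun h => absurd h hm⟩
  choose AD hAD using exAD
  choose BC hBC using exBC
  obtain ⟨⟨c, hmaj⟩, hsol⟩ := Plate.series_isWeakSolution hℓ hσ₀ hσ₁ hα₀ hα hg hAD hBC
  refine ⟨_, hsol, fun w hw => hw.eqOn hℓ hσ₀ hσ₁ hsol, fun A B C D hA hB => ?_⟩
  -- By uniqueness for the systems, any admissible coefficients equal the chosen ones for `m ≥ 1`.
  -- The arbitrary values at `m = 0` never enter, since the series starts at `n + 1`.
  have hterm : ∀ n p, Plate.seriesTerm α g (fun m => (AD m).1) (fun m => (BC m).1)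
      (fun m => (BC m).2) (fun m => (AD m).2) (n + 1) p =
      Plate.seriesTerm α g A B C D (n + 1) p := by
    intro n p
    have hn : 1 ≤ n + 1 := Nat.le_add_left 1 n
    have e1 : AD (n + 1) = (A (n + 1), D (n + 1)) :=
      (hsysAD _ hn).unique (hAD _ hn) (hA _ hn)
    have e2 : BC (n + 1) = (B (n + 1), C (n + 1)) :=
      (hsysBC _ hn).unique (hBC _ hn) (hB _ hn)
    simp only [Plate.seriesTerm, e1, e2]
  simp only [hterm] at hmaj ⊢
  refine ⟨fun p hp => ⟨?_, tsum_mul_left⟩, ?_⟩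
  · refine (summable_mul_left_iff (Plate.loadConst_ne_zero hℓ hα₀ hg hg₀)).1 ?_
    exact Summable.of_norm_bounded hmaj.summable fun n => hmaj.bound n p hp
  · refine (tendstoUniformlyOn_tsum_nat hmaj.summable hmaj.bound).congr
      (Eventually.of_forall fun N p _ => ?_)
    dsimp only
    rw [← Finset.mul_sum,
      Plate.sum_range_succ_eq_sum_Icc (fun m => Plate.seriesTerm α g A B C D m p)]
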